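/- **Conventions.** Let $X$ be a countably infinite alphabet, $X^*$ the free monoid of words over $X$; $x,y,z,t,s$ are distinct letters of $X$. An identity $u\approx v$ is a pair of words; it holds in a monoid $M$ if every substitution $X\to M$ gives $u$ and $v$ the same value. A variety of monoids is the class $\mathrm{var}\,\Sigma$ of all monoids satisfying some set $\Sigma$ of identities. Varieties are ordered by inclusion; $\vee$ is the join of varieties, and the subvarieties of a variety form a lattice. $\mathrm{FIC}(\mathbf V)$ is the congruence on $X^*$ consisting of all $(u,v)$ such that $u\approx v$ holds in $\mathbf V$. For a congruence $\alpha$ on $X^*$ and a word $w$, let $[w]^\alpha$ be the $\alpha$-class of $w$, let $M_\alpha([w]^\alpha)$ be the Rees quotient of $X^*/\alpha$ over the ideal of all elements that do not divide $[w]^\alpha$ (where $b$ divides $a$ if $a=pbq$ for some $p,q\in X^*/\alpha$), and let $\mathbf M_\alpha([w]^\alpha)$ be the variety generated by this monoid. If $\alpha$ is the equality relation, write $\mathbf M(w)$. A class is also written by a regular expression, with $x^+=\{x^n: n\ge 1\}$; e.g. $xx^+y=[x^2y]^\gamma$, $xyx^+=[xyx]^\lambda$. A letter is simple (multiple) in a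 word if it occurs there exactly once (at least twice). The congruences used are: * $u\mathrel\gamma v$ iff $u$ and $v$ have the same simple letters and $u$ is obtained from $v$ by changing the (positive) exponents of individual letters; * $u\mathrel\lambda v$ iff $u\mathrel\gamma v$ and, for each multiple letter, its first two occurrences are adjacent in $u$ iff they are adjacent in $v$; * $\overline\lambda$, the dual of $\lambda$: $u\mathrel{\overline\lambda}v$ iff the words $u,v$ read from right to left are $\lambda$-related; * $\gamma'=\gamma\wedge\mathrm{FIC}(\mathbf M(xyx))$ and $\lambda'=\lambda\wedge\mathrm{FIC}(\mathbf M(xyx))$; * $\nu=\mathrm{FIC}(\mathrm{var}\{xy\approx xyx\}\vee\mathbf M(xyx))$; * $\eta=\mathrm{FIC}(\mathrm{var}\{xyxz\approx xyxzx,\ ytx^2y\approx ytyx^2\}\vee\mathbf M(xyx))$; * $\mu=\mathrm{FIC}(\mathrm{var}\{x^2\approx x^3,\ xyxzx\approx xyxzx^2\})$. Finally, let $$\mathbf H=\mathrm{var}\{x^2\approx x^3,\ x^2y^2\approx y^2x^2,\ xyx\approx xyx^2,\ x^2y\approx x^2yx,\ xyxty\approx yx^2ty\},$$ $$\mathbf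 N=\mathrm{var}\{x^2\approx x^3,\ x^2y\approx yx^2,\ xyxzx\approx x^2yz,\ xzytxy\approx xzytyx,\ xzxyty\approx xzyxty\}.$$ **Proposition.** Each of the following varieties of monoids has a non-modular lattice of subvarieties: - (i) $\mathbf M_\gamma(xx^+y)\vee\mathbf H$; - (ii) $\mathbf M_\gamma(xx^+y)\vee\mathbf M_\nu([yx^2ty]^\nu)$; - (iii) $\mathbf M_\gamma(xx^+y)\vee\mathbf M_\eta([xyzx^2ty]^\eta)$; - (iv) $\mathbf M_\lambda(xyx^+)\vee\mathbf M_{\overline\lambda}(x^+yx)$; - (v) $\mathbf M_\lambda(xyx^+)\vee\mathbf M_\nu([yx^2ty]^\nu)$; - (vi) $\mathbf M_\lambda(xyx^+)\vee\mathbf M_{\gamma'}(yxx^+ty)$; - (vii) $\mathbf M_\lambda(xyx^+)\vee\mathbf M_{\gamma'}(ytyxx^+)$; - (viii) $\mathbf M_\lambda(xyx^+)\vee\mathbf M_{\gamma'}([x^2yzytx^2]^{\gamma'})$; - (ix) $\mathbf M_\lambda(xyx^+)\vee\mathbf M_{\gamma'}([x^2yzx^2ty]^{\gamma'})$; - (x)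 $\mathbf M_\lambda(xyx^+)\vee\mathbf M_{\gamma'}([yzx^2ytx^2]^{\gamma'})$; - (xi) $\mathbf M_\lambda(xyx^+)\vee\mathbf M_{\gamma'}([x^2zytx^2y]^{\gamma'})$; - (xii) $\mathbf M(xyx)\vee\mathbf H$; - (xiii) $\mathbf M(xyx)\vee\mathbf M_\lambda(xyzx^+ty^+)$; - (xiv) $\mathbf M(xyx)\vee\mathbf M_\lambda(xx^+yty^+)$; - (xv) $\mathbf M(xyxzx)\vee\mathbf M_\nu([yx^2ty]^\nu)$; - (xvi) $\mathbf M(xyxzx)\vee\mathbf M_{\gamma'}(yxx^+ty)$; - (xvii) $\mathbf M(xyxzx)\vee\mathbf M_{\gamma'}(xx^+yty)$; - (xviii) $\mathbf M(xyxzx)\vee\mathbf M_{\lambda'}(xyzxx^+ty)$; - (xix) $\mathbf M(xyxzx)\vee\mathbf M_{\lambda'}(xyzytxx^+)$; - (xx) $\mathbf M(xyxzx)\vee\mathbf M_{\lambda'}(yzyxtxx^+)$; - (xxi) $\mathbf M_\mu(xyxzx^+)\vee\mathbf M_{\lambda'}(xyzx^+tysx^+)$; - (xxii) $\mathbf M_\mu(xyxzx^+)\vee\mathbf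 M_\eta([xyzx^2ty]^\eta)$; - (xxiii) $\mathbf M(xzxyty)\vee\mathbf N$; - (xxiv) $\mathbf M(xzytxy)\vee\mathbf N$. -/

import Mathlib

namespace MonVar

/-! ### Words, identities, varieties of monoids -/

/-- Words over a countably infinite alphabet: the free monoid on the letters `0, 1, 2, …`. -/
abbrev Word := FreeMonoid ℕ

/-- The identity `u ≈ v`, encoded as the pair `(u, v)`, holds in `M`:
every substitution of the letters by elements of `M` gives the two words the same value. -/
def Satisfies (M : Type*) [Monoid M] (e : Word × Word) : Prop :=
  ∀ φ : ℕ → M, FreeMonoid.lift φ e.1 = FreeMonoid.lift φ e.2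

/-- The class of all monoids satisfying a set of identities. -/
def models (S : Set (Word × Word)) : Set MonCat.{0} :=
  {M | ∀ e ∈ S, Satisfies M e}

/-- A variety of monoids: a class of monoids which consists of all monoids
satisfying some set of identities. -/
structure Variety where
  carrier : Set MonCat.{0}
  equational : ∃ S : Set (Word × Word), carrier = models S

namespace Variety

@[ext]
theorem ext {V W : Variety} (h : V.carrier = W.carrier) : V = W := by
  cases V; cases W; cases h; rfl

/-- Varieties are ordered by inclusion of classes. -/
instance : PartialOrder Variety :=
  PartialOrder.lift Variety.carrier fun _ _ h => ext h

theorem le_def {V W : Variety} : V ≤ W ↔ V.carrier ⊆ W.carrier := Iff.rfl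

/-- The infimum of a set of varieties is the intersection of the classes. -/
instance : InfSet Variety where
  sInf 𝒱 :=
    { carrier := ⋂ V ∈ 𝒱, V.carrier
      equational := by
        refine ⟨⋃ V ∈ 𝒱, Classical.choose V.equational, ?_⟩
        ext M
        have key : ∀ V : Variety, M ∈ V.carrier ↔
            ∀ e ∈ Classical.choose V.equational, Satisfies M e := by
          intro V
          have h := Classical.choose_spec V.equational
          constructor
          · intro hM
            rw [h] at hM
            exact hM
          · intro hM
            rw [h]
            exact hM
        simp only [models, Set.mem_iInter, Set.mem_ofPred_eq, Set.mem_iUnion, key]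
        constructor
        · rintro h e ⟨V, hV, he⟩
          exact h V hV e he
        · intro h V hV e he
          exact h e ⟨V, hV, he⟩ }

theorem mem_sInf {𝒱 : Set Variety} {M : MonCat.{0}} :
    M ∈ (sInf 𝒱).carrier ↔ ∀ V ∈ 𝒱, M ∈ V.carrier := by
  simp [sInf]

/-- The complete lattice of all varieties of monoids: the meet is the intersection and the join
is the least variety containing the given ones. -/
instance : CompleteLattice Variety :=
  completeLatticeOfInf Variety fun _ =>
    ⟨fun V hV _ hM => mem_sInf.1 hM V hV,
      fun _ hW _ hM => mem_sInf.2 fun _ hV => hW hV hM⟩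

end Variety

/-- `var Σ`: the variety given by a set `Σ` of identities. -/
def var (S : Set (Word × Word)) : Variety := ⟨models S, S, rfl⟩

/-- The variety generated by a monoid: the least variety containing it. -/
def generatedBy (M : Type) [Monoid M] : Variety :=
  sInf {V | MonCat.of M ∈ V.carrier}

/-- The lattice of subvarieties of `V` is not modular. -/
def HasNonmodularSubvarietyLattice (V : Variety) : Prop :=
  ¬ IsModularLattice (Set.Iic V)

/-- `FIC(V)`: the fully invariant congruence of all identities holding in the variety `V`. -/
def FIC (V : Variety) : Con Word where
  r u v := ∀ M ∈ V.carrier, Satisfies M (u, v)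
  iseqv :=
    ⟨fun _ _ _ _ => rfl, fun h M hM φ => (h M hM φ).symm,
      fun h h' M hM φ => (h M hM φ).trans (h' M hM φ)⟩
  mul' := by
    intro a b c d h h' M hM φ
    have h1 := h M hM φ
    have h2 := h' M hM φ
    simp only at h1 h2
    simp only [map_mul, h1, h2]

/-! ### Rees quotients and Sapir's construction -/

/-- The closure of `W` under taking factors. -/
def factors {S : Type*} [Monoid S] (W : Set S) : Set S :=
  {v | ∃ u ∈ W, ∃ p s, u = p * v * s}

/-- The Rees congruence on `S` over the ideal of all elements that are not factors of elements
of `W`: this ideal is collapsed to one element, and nothing else is identified. -/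
def reesCon {S : Type*} [Monoid S] (W : Set S) : Con S where
  r a b := a = b ∨ (a ∉ factors W ∧ b ∉ factors W)
  iseqv := by
    refine ⟨fun _ => Or.inl rfl, ?_, ?_⟩
    · rintro a b (h | ⟨h, h'⟩)
      · exact Or.inl h.symm
      · exact Or.inr ⟨h', h⟩
    · rintro a b c (rfl | ⟨h, h'⟩) hbc
      · exact hbc
      · rcases hbc with rfl | ⟨_, h''⟩
        · exact Or.inr ⟨h, h'⟩
        · exact Or.inr ⟨h, h''⟩
  mul' := by
    have hl : ∀ a c : S, a ∉ factors W → a * c ∉ factors W := by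
      rintro a c ha ⟨u, hu, p, s, rfl⟩
      exact ha ⟨_, hu, p, c * s, by simp only [mul_assoc]⟩
    have hr : ∀ a c : S, c ∉ factors W → a * c ∉ factors W := by
      rintro a c hc ⟨u, hu, p, s, rfl⟩
      exact hc ⟨_, hu, p * a, s, by simp only [mul_assoc]⟩
    rintro a b c d (rfl | ⟨h, h'⟩) (rfl | ⟨k, k'⟩)
    · exact Or.inl rfl
    · exact Or.inr ⟨hr _ _ k, hr _ _ k'⟩
    · exact Or.inr ⟨hl _ _ h, hl _ _ h'⟩
    · exact Or.inr ⟨hl _ _ h, hl _ _ h'⟩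

/-- The variety generated by `M(w)`, the Rees quotient of the free monoid over the ideal of all
words that are not factors of `w`. -/
def varM (w : Word) : Variety := generatedBy (reesCon ({w} : Set Word)).Quotient

/-- The variety generated by `M_α(𝚠)` for the `α`-class `𝚠 = [w]^α`: the Rees quotient of
`X* / α` over the ideal of all `α`-classes that do not divide `[w]^α`. -/
def varMα (α : Con Word) (w : Word) : Variety :=
  generatedBy (reesCon ({(w : α.Quotient)} : Set α.Quotient)).Quotient

/-! ### The congruences `γ` and `λ` -/

/-- The number of occurrences of the letter `a` in `w`. -/
def occ (a : ℕ) (w : Word) : ℕ := (FreeMonoid.toList w).count a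

/-- The simple letters of `w`: those occurring exactly once. -/
def sim (w : Word) : Set ℕ := {a | occ a w = 1}

/-- Replace every maximal power of a letter in `w` by one occurrence of this letter. Two words
can be obtained from each other by changing the (positive) exponents of letters if and only if
these reduced forms coincide. -/
def squash (w : Word) : List ℕ := (FreeMonoid.toList w).destutter (· ≠ ·)

/-- The first two occurrences of `a` in `w` exist and are adjacent: the suffix of `w` beginning at
the first occurrence of `a` begins with `aa`. -/
def FirstTwoAdjacent (a : ℕ) (w : Word) : Prop :=
  [a, a] <+: (FreeMonoid.toList w).dropWhile (· != a)

/-- One step of `squash`, read from the right. -/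
def sqStep (a : ℕ) (l : List ℕ) : List ℕ := if l.head? = some a then l else a :: l

theorem head?_sqStep (a : ℕ) (l : List ℕ) : (sqStep a l).head? = some a := by
  unfold sqStep; split_ifs with h <;> simp [h]

theorem sqStep_sqStep (a : ℕ) (l : List ℕ) : sqStep a (sqStep a l) = sqStep a l := by
  exact if_pos (head?_sqStep a l)

theorem destutter'_eq (l : List ℕ) : ∀ a : ℕ,
    l.destutter' (· ≠ ·) a = sqStep a (l.foldr sqStep []) := by
  induction l with
  | nil => intro a; simp [sqStep]
  | cons b l ih =>
    intro a
    rw [List.destutter'_cons, List.foldr_cons]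
    by_cases h : a = b
    · subst h
      simp only [ne_eq, not_true_eq_false, if_false, sqStep_sqStep, ih]
    · rw [if_pos h, ih b]
      refine (if_neg ?_).symm
      rw [head?_sqStep]
      simpa using fun h' => h h'.symm

theorem squash_eq (w : Word) : squash w = (FreeMonoid.toList w).foldr sqStep [] := by
  unfold squash
  cases h : FreeMonoid.toList w with
  | nil => rfl
  | cons a l => rw [List.destutter_cons', destutter'_eq]; rfl

theorem foldr_sqStep (l m : List ℕ) :
    l.foldr sqStep m = (l.foldr sqStep []).foldr sqStep m := by
  induction l with
  | nil => rfl
  | cons a l ih =>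
    rw [List.foldr_cons, List.foldr_cons, ih]
    generalize l.foldr sqStep [] = k
    by_cases h : k.head? = some a
    · cases k with
      | nil => simp at h
      | cons b k =>
        obtain rfl : b = a := by simpa using h
        rw [show sqStep b (b :: k) = b :: k by simp [sqStep], List.foldr_cons, sqStep_sqStep]
    · rw [show sqStep a k = a :: k by simp [sqStep, h], List.foldr_cons]

theorem squash_mul {u u' v v' : Word} (h : squash u = squash u') (h' : squash v = squash v') :
    squash (u * v) = squash (u' * v') := by
  simp only [squash_eq] at h h' ⊢
  rw [FreeMonoid.toList_mul, FreeMonoid.toList_mul, List.foldr_append, List.foldr_append,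
    foldr_sqStep, h, h', ← foldr_sqStep]

theorem mem_iff_squash (a : ℕ) (w : Word) : a ∈ FreeMonoid.toList w ↔ a ∈ squash w := by
  rw [squash_eq]
  induction FreeMonoid.toList w with
  | nil => rfl
  | cons b l ih =>
    rw [List.foldr_cons, List.mem_cons, ih]
    generalize l.foldr sqStep [] = k
    unfold sqStep
    split_ifs with h
    · constructor
      · rintro (rfl | h')
        · exact List.mem_of_mem_head? h
        · exact h'
      · exact Or.inr
    · exact List.mem_cons.symm

theorem head?_squash (w : Word) : (squash w).head? = (FreeMonoid.toList w).head? := by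
  rw [squash_eq]
  cases FreeMonoid.toList w with
  | nil => rfl
  | cons b l => rw [List.foldr_cons, head?_sqStep]; rfl

theorem getLast?_squash (w : Word) : (squash w).getLast? = (FreeMonoid.toList w).getLast? := by
  rw [squash_eq]
  induction FreeMonoid.toList w with
  | nil => rfl
  | cons b l ih =>
    rw [List.foldr_cons, List.getLast?_cons, ← ih]
    generalize l.foldr sqStep [] = k
    unfold sqStep
    split_ifs with h
    · cases k with
      | nil => simp at h
      | cons c k => simp [List.getLast?_cons]
    · rw [List.getLast?_cons]

theorem occ_mul (a : ℕ) (u v : Word) : occ a (u * v) = occ a u + occ a v := by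
  simp [occ, FreeMonoid.toList_mul, List.count_append]

theorem occ_eq_zero (a : ℕ) (w : Word) : occ a w = 0 ↔ a ∉ squash w := by
  rw [← mem_iff_squash]; exact List.count_eq_zero

/-- `u γ v`: the words `u` and `v` have the same simple letters, and `u` can be obtained from `v`
by changing the individual exponents of letters. -/
def gam : Con Word where
  r u v := sim u = sim v ∧ squash u = squash v
  iseqv := ⟨fun _ => ⟨rfl, rfl⟩, fun h => ⟨h.1.symm, h.2.symm⟩,
    fun h h' => ⟨h.1.trans h'.1, h.2.trans h'.2⟩⟩
  mul' := by
    rintro u u' v v' ⟨h1, h2⟩ ⟨k1, k2⟩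
    refine ⟨?_, squash_mul h2 k2⟩
    ext a
    have e1 : occ a u = 1 ↔ occ a u' = 1 := Set.ext_iff.1 h1 a
    have e2 : occ a v = 1 ↔ occ a v' = 1 := Set.ext_iff.1 k1 a
    have e3 : occ a u = 0 ↔ occ a u' = 0 := by rw [occ_eq_zero, occ_eq_zero, h2]
    have e4 : occ a v = 0 ↔ occ a v' = 0 := by rw [occ_eq_zero, occ_eq_zero, k2]
    simp only [sim, Set.mem_ofPred_eq, occ_mul]
    omega

theorem dropWhile_of_notMem {a : ℕ} {l : List ℕ} (h : a ∉ l) (m : List ℕ) :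
    (l ++ m).dropWhile (· != a) = m.dropWhile (· != a) := by
  induction l with
  | nil => rfl
  | cons b l ih =>
    simp only [List.mem_cons, not_or] at h
    rw [List.cons_append, List.dropWhile_cons_of_pos (by simpa using Ne.symm h.1), ih h.2]

theorem firstTwoAdjacent_mul (a : ℕ) (u v : Word) : FirstTwoAdjacent a (u * v) ↔
    (occ a u = 0 ∧ FirstTwoAdjacent a v) ∨
    (occ a u = 1 ∧ (squash u).getLast? = some a ∧ (squash v).head? = some a) ∨
    (2 ≤ occ a u ∧ FirstTwoAdjacent a u) := by
  rw [getLast?_squash, head?_squash]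
  unfold FirstTwoAdjacent occ
  rw [FreeMonoid.toList_mul]
  generalize FreeMonoid.toList u = l
  generalize FreeMonoid.toList v = m
  by_cases ha : a ∈ l
  · obtain ⟨p, r, rfl, hp⟩ := List.eq_append_cons_of_mem ha
    have hc : (p ++ a :: r).count a = r.count a + 1 := by
      simp [List.count_append, List.count_eq_zero.2 hp]
    rw [hc, List.append_assoc, dropWhile_of_notMem hp, dropWhile_of_notMem hp, List.cons_append,
      List.dropWhile_cons_of_neg (by simp), List.dropWhile_cons_of_neg (by simp),
      List.cons_prefix_cons, List.cons_prefix_cons]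
    cases r with
    | nil =>
      cases m with
      | nil => simp
      | cons c m =>
        simp only [List.nil_append, List.cons_prefix_cons, List.nil_prefix, and_true, true_and,
          List.count_nil, List.head?_cons, Option.some.injEq, List.getLast?_concat]
        constructor
        · rintro rfl
          exact Or.inr (Or.inl rfl)
        · rintro (⟨h, _⟩ | h | ⟨h, _⟩)
          · omega
          · exact h.symm
          · omega
    | cons b r =>
      have hlast : (p ++ a :: b :: r).getLast? = (b :: r).getLast? := by
        simp [List.getLast?_append, List.getLast?_cons]
      rw [hlast]
      simp only [List.cons_append, List.cons_prefix_cons, List.nil_prefix, and_true, true_and]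
      constructor
      · rintro rfl
        right; right
        simp
      · rintro (⟨h, _⟩ | ⟨h, h', _⟩ | ⟨_, h⟩)
        · omega
        · exact absurd (List.mem_of_getLast? h') (List.count_eq_zero.1 (by omega))
        · exact h
  · have hc := List.count_eq_zero.2 ha
    rw [dropWhile_of_notMem ha, hc]
    simp

/-- `u λ v`: `u γ v`, and the first two occurrences of each multiple letter are adjacent in `u`
if and only if they are adjacent in `v` (words related by `γ` have the same multiple letters). -/
def lam : Con Word where
  r u v := gam u v ∧ ∀ a, 2 ≤ occ a u → (FirstTwoAdjacent a u ↔ FirstTwoAdjacent a v)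
  iseqv := by
    have e : ∀ {u v : Word}, gam u v → ∀ a, 2 ≤ occ a u ↔ 2 ≤ occ a v := by
      rintro u v ⟨h1, h2⟩ a
      have e1 : occ a u = 1 ↔ occ a v = 1 := Set.ext_iff.1 h1 a
      have e3 : occ a u = 0 ↔ occ a v = 0 := by rw [occ_eq_zero, occ_eq_zero, h2]
      omega
    exact ⟨fun u => ⟨gam.refl u, fun _ _ => Iff.rfl⟩,
      fun h => ⟨gam.symm h.1, fun a ha => (h.2 a ((e h.1 a).2 ha)).symm⟩,
      fun h h' => ⟨gam.trans h.1 h'.1,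
        fun a ha => (h.2 a ha).trans (h'.2 a ((e h.1 a).1 ha))⟩⟩
  mul' := by
    rintro u u' v v' ⟨h, hu⟩ ⟨k, hv⟩
    refine ⟨gam.mul h k, fun a ha => ?_⟩
    have e1 : occ a u = 1 ↔ occ a u' = 1 := Set.ext_iff.1 h.1 a
    have e3 : occ a u = 0 ↔ occ a u' = 0 := by rw [occ_eq_zero, occ_eq_zero, h.2]
    rw [firstTwoAdjacent_mul, firstTwoAdjacent_mul, ← h.2, ← k.2, ← e1, ← e3]
    rw [occ_mul] at ha
    rcases (show occ a u = 0 ∨ occ a u = 1 ∨ 2 ≤ occ a u by omega) with h0 | h0 | h0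
    · have := hv a (by omega)
      have h2 : ¬ 2 ≤ occ a u' := by omega
      simp [h0, h2, this]
    · have h2 : ¬ 2 ≤ occ a u' := by omega
      simp [h0, h2]
    · have := hu a h0
      have h2 : 2 ≤ occ a u' := by omega
      have h3 : occ a u ≠ 0 := by omega
      have h4 : occ a u ≠ 1 := by omega
      simp [h0, h2, h3, h4, this]

/-- The congruence dual to `α`: it relates `u` and `v` if and only if `α` relates these words read
from right to left. -/
def dualCon (α : Con Word) : Con Word where
  r u v := α u.reverse v.reverse
  iseqv := ⟨fun _ => α.refl _, fun h => α.symm h, fun h h' => α.trans h h'⟩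
  mul' := by
    intro a b c d h h'
    rw [FreeMonoid.reverse_mul, FreeMonoid.reverse_mul]
    exact α.mul h' h

/-! ### Letters, and the remaining congruences and varieties -/

/-- The letters `x, y, z, t, s` are pairwise distinct. -/
def x : Word := FreeMonoid.of 0
def y : Word := FreeMonoid.of 1
def z : Word := FreeMonoid.of 2
def t : Word := FreeMonoid.of 3
def s : Word := FreeMonoid.of 4

/-- `γ' = γ ∧ FIC(𝐌(xyx))`. -/
def gam' : Con Word := gam ⊓ FIC (varM (x * y * x))

/-- `λ' = λ ∧ FIC(𝐌(xyx))`. -/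
def lam' : Con Word := lam ⊓ FIC (varM (x * y * x))

/-- `ν = FIC(var{xy ≈ xyx} ∨ 𝐌(xyx))`. -/
def nu : Con Word := FIC (var {(x * y, x * y * x)} ⊔ varM (x * y * x))

/-- `η = FIC(var{xyxz ≈ xyxzx, ytx²y ≈ ytyx²} ∨ 𝐌(xyx))`. -/
def eta : Con Word :=
  FIC (var {(x * y * x * z, x * y * x * z * x), (y * t * x ^ 2 * y, y * t * y * x ^ 2)} ⊔
    varM (x * y * x))

/-- `μ = FIC(var{x² ≈ x³, xyxzx ≈ xyxzx²})`. -/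
def mu : Con Word :=
  FIC (var {(x ^ 2, x ^ 3), (x * y * x * z * x, x * y * x * z * x ^ 2)})

/-- `𝐃₁ = var{x² ≈ x³, x²y² ≈ y²x², xyx ≈ xyx², x²y ≈ x²yx}`. -/
def D₁ : Variety :=
  var {(x ^ 2, x ^ 3), (x ^ 2 * y ^ 2, y ^ 2 * x ^ 2), (x * y * x, x * y * x ^ 2),
    (x ^ 2 * y, x ^ 2 * y * x)}

/-- The subvariety `𝐇` of `𝐃₁` defined within `𝐃₁` by `xyxty ≈ yx²ty`. -/
def H : Variety := D₁ ⊓ var {(x * y * x * t * y, y * x ^ 2 * t * y)}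

/-- `𝐍 = var{x² ≈ x³, x²y ≈ yx², xyxzx ≈ x²yz, σ₂, σ₃}` with `σ₂ : xzytxy ≈ xzytyx` and
`σ₃ : xzxyty ≈ xzyxty`. -/
def N : Variety :=
  var {(x ^ 2, x ^ 3), (x ^ 2 * y, y * x ^ 2), (x * y * x * z * x, x ^ 2 * y * z),
    (x * z * y * t * x * y, x * z * y * t * y * x), (x * z * x * y * t * y, x * z * y * x * t * y)}

end MonVar

open MonVar

/-! For each join `A ∨ B` choose identities `u ≈ v` and `e₁ ≈ e₂` which hold in `A`, such that
`u ≈ e₁` and `v ≈ e₂` hold in `B` but `u ≈ v` does not. Put `C = (A ∨ B) ∧ var{e₁ ≈ e₂}`, so that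
`A ≤ C` and `B ∧ C` satisfies `u ≈ v`. If the subvarieties of `A ∨ B` formed a modular lattice,
then `C = (A ∨ B) ∧ C = A ∨ (B ∧ C)` would satisfy `u ≈ v`. It does not: the syntactic monoid of
the set `S` of all words `p` such that `u ≈ p` holds in `A ∨ B` violates `u ≈ v`, and it lies in
`C` once `φ(e₁) = φ(e₂)` for all substitutions `φ` such that `a φ(e₁) b` or `a φ(e₂) b` is in `S`.

In (iv) a substitution of this kind erases `x`, because no letter occurs three times in a word from
`S`. In the other cases `u` and `v`, and also `e₁` and `e₂`, differ only by the order of two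
adjacent letters `x` and `y`, and thus `φ(x)` and `φ(y)` have to commute. They do because the words
from `S` avoid certain scattered subwords, while two distinct letters in `φ(xy)` would create one.
-/

namespace MonVar

open FreeMonoid (of lift toList)

/-! ### Varieties and their identities -/

theorem FIC_iff_le_var {V : Variety} {u v : Word} : FIC V u v ↔ V ≤ var {(u, v)} :=
  ⟨fun h M hM _ he => he ▸ h M hM, fun h _ hM => h hM _ rfl⟩

theorem FIC_var {S : Set (Word × Word)} {u v : Word} (h : (u, v) ∈ S) : FIC (var S) u v :=
  fun _ hM => hM _ h

theorem FIC_mono {V W : Variety} (hVW : V ≤ W) {u v : Word} (h : FIC W u v) : FIC V u v :=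
  fun M hM => h M (hVW hM)

theorem FIC_sup {V W : Variety} {u v : Word} : FIC (V ⊔ W) u v ↔ FIC V u v ∧ FIC W u v := by
  simp only [FIC_iff_le_var, sup_le_iff]

theorem mem_iff_generatedBy_le {V : Variety} {M : Type} [Monoid M] :
    MonCat.of M ∈ V.carrier ↔ generatedBy M ≤ V :=
  ⟨fun h => sInf_le h, fun h => h (Variety.mem_sInf.2 fun _ hW => hW)⟩

theorem mem_inf {V W : Variety} {M : Type} [Monoid M] :
    MonCat.of M ∈ (V ⊓ W).carrier ↔ MonCat.of M ∈ V.carrier ∧ MonCat.of M ∈ W.carrier := by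
  simp only [mem_iff_generatedBy_le, le_inf_iff]

theorem mem_var_singleton {M : Type} [Monoid M] {e : Word × Word} :
    MonCat.of M ∈ (var {e}).carrier ↔ Satisfies M e :=
  ⟨fun h => h e rfl, fun h _ he => he ▸ h⟩

theorem FIC_generatedBy {M : Type} [Monoid M] {u v : Word} :
    FIC (generatedBy M) u v ↔ Satisfies M (u, v) := by
  rw [FIC_iff_le_var, ← mem_iff_generatedBy_le, mem_var_singleton]

theorem le_of_FIC {V W : Variety} (h : ∀ u v, FIC W u v → FIC V u v) : V ≤ W := by
  obtain ⟨S, hS⟩ := W.equational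
  rw [Variety.le_def, hS]
  intro M hM e he
  exact h e.1 e.2 (fun N hN => (hS ▸ hN : N ∈ models S) e he) M hM

theorem lift_of (u : Word) : lift of u = u :=
  DFunLike.congr_fun (FreeMonoid.lift_restrict (MonoidHom.id Word)) u

theorem FIC_lift {V : Variety} {u v : Word} (h : FIC V u v) (φ : ℕ → Word) :
    FIC V (lift φ u) (lift φ v) := by
  intro M hM ψ
  simp only [FreeMonoid.hom_map_lift]
  exact h M hM _

theorem satisfies_iff_of_surjective {Q : Type*} [Monoid Q] (π : Word →* Q)
    (hπ : Function.Surjective π) {u v : Word} :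
    Satisfies Q (u, v) ↔ ∀ φ : ℕ → Word, π (lift φ u) = π (lift φ v) := by
  simp only [FreeMonoid.hom_map_lift]
  refine ⟨fun h φ => h _, fun h ψ => ?_⟩
  obtain ⟨φ, rfl⟩ := hπ.comp_left ψ
  exact h φ

/-- The largest fully invariant congruence saturating the set `S` of words; its quotient is the
analogue of the syntactic monoid of `S` for identities. -/
def syntacticCon (S : Set Word) : Con Word where
  r u v := ∀ (φ : ℕ → Word) (a b : Word), a * lift φ u * b ∈ S ↔ a * lift φ v * b ∈ S
  iseqv := ⟨fun _ _ _ _ => Iff.rfl, fun h φ a b => (h φ a b).symm,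
    fun h h' φ a b => (h φ a b).trans (h' φ a b)⟩
  mul' := by
    intro u u' v v' h h' φ a b
    have hu := h φ a (lift φ v * b)
    have hv := h' φ (a * lift φ u') b
    simp only [map_mul, mul_assoc] at hu hv ⊢
    exact hu.trans hv

theorem satisfies_syntacticCon {S : Set Word} {u v : Word} :
    Satisfies (syntacticCon S).Quotient (u, v) ↔ syntacticCon S u v := by
  rw [satisfies_iff_of_surjective (syntacticCon S).mk' Con.mk'_surjective]
  constructor
  · intro h
    simpa only [lift_of] using (Con.eq _).1 (h of)
  · refine fun h φ => (Con.eq _).2 fun ψ a b => ?_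
    simp only [FreeMonoid.hom_map_lift]
    exact h _ a b

theorem mem_iff_of_syntacticCon {S : Set Word} {u v : Word} (h : syntacticCon S u v) :
    u ∈ S ↔ v ∈ S := by
  simpa only [lift_of, one_mul, mul_one] using h of 1 1

theorem mem_iff_of_FIC {V : Variety} {S : Set Word}
    (hS : MonCat.of (syntacticCon S).Quotient ∈ V.carrier) {u v : Word} (h : FIC V u v) :
    u ∈ S ↔ v ∈ S :=
  mem_iff_of_syntacticCon (satisfies_syntacticCon.1 (h _ hS))

theorem syntacticCon_class_mem (V : Variety) (u : Word) :
    MonCat.of (syntacticCon {p | FIC V u p}).Quotient ∈ V.carrier := by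
  rw [mem_iff_generatedBy_le]
  refine le_of_FIC fun p q hpq => FIC_generatedBy.2 (satisfies_syntacticCon.2 fun φ a b => ?_)
  have hctx : FIC V (a * lift φ p * b) (a * lift φ q * b) :=
    (FIC V).mul ((FIC V).mul ((FIC V).refl a) (FIC_lift hpq φ)) ((FIC V).refl b)
  exact ⟨fun h => (FIC V).trans h hctx, fun h => (FIC V).trans h ((FIC V).symm hctx)⟩

theorem syntacticCon_of_lift_eq {S : Set Word} {e₁ e₂ : Word}
    (h : ∀ (φ : ℕ → Word) (a b : Word), a * lift φ e₁ * b ∈ S ∨ a * lift φ e₂ * b ∈ S →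
      lift φ e₁ = lift φ e₂) : syntacticCon S e₁ e₂ :=
  fun φ a b => ⟨fun hp => h φ a b (Or.inl hp) ▸ hp, fun hp => h φ a b (Or.inr hp) ▸ hp⟩

/-! ### Criteria for non-modularity -/

theorem not_isModularLattice_Iic_sup {α : Type*} [Lattice α] {a b c d : α} (hac : a ≤ c)
    (hc : c ≤ a ⊔ b) (had : a ≤ d) (hbc : b ⊓ c ≤ d) (hcd : ¬ c ≤ d) :
    ¬ IsModularLattice (Set.Iic (a ⊔ b)) := by
  intro _
  let a' : Set.Iic (a ⊔ b) := ⟨a, Set.mem_Iic.2 le_sup_left⟩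
  let b' : Set.Iic (a ⊔ b) := ⟨b, Set.mem_Iic.2 le_sup_right⟩
  let c' : Set.Iic (a ⊔ b) := ⟨c, Set.mem_Iic.2 hc⟩
  have hac' : a' ≤ c' := hac
  have hmodular : (a ⊔ b) ⊓ c ≤ a ⊔ b ⊓ c :=
    IsModularLattice.sup_inf_le_assoc_of_le (x := a') b' hac'
  exact hcd (((le_inf hc le_rfl).trans hmodular).trans (sup_le had hbc))

theorem nonmodular_of_trivial_instances {A B : Variety} {e₁ e₂ u v : Word} (hA : FIC A e₁ e₂)
    (hAuv : FIC A u v) (hB : B ⊓ var {(e₁, e₂)} ≤ var {(u, v)}) (huv : ¬ FIC (A ⊔ B) u v)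
    (h : ∀ (φ : ℕ → Word) (a b : Word),
      FIC (A ⊔ B) u (a * lift φ e₁ * b) ∨ FIC (A ⊔ B) u (a * lift φ e₂ * b) →
        lift φ e₁ = lift φ e₂) :
    HasNonmodularSubvarietyLattice (A ⊔ B) := by
  have hQ : MonCat.of (syntacticCon {p | FIC (A ⊔ B) u p}).Quotient ∈
      ((A ⊔ B) ⊓ var {(e₁, e₂)}).carrier :=
    mem_inf.2 ⟨syntacticCon_class_mem _ u,
      mem_var_singleton.2 (satisfies_syntacticCon.2 (syntacticCon_of_lift_eq h))⟩
  refine not_isModularLattice_Iic_sup (c := (A ⊔ B) ⊓ var {(e₁, e₂)}) (d := var {(u, v)})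
    (le_inf le_sup_left (FIC_iff_le_var.1 hA)) inf_le_left (FIC_iff_le_var.1 hAuv)
    ((inf_le_inf_left B inf_le_right).trans hB) fun hle => huv ?_
  exact (mem_iff_of_FIC hQ (FIC_iff_le_var.2 hle)).1 ((FIC (A ⊔ B)).refl u)

theorem inf_var_le_var {B : Variety} {e₁ e₂ u v : Word} (hu : FIC B u e₁) (hv : FIC B v e₂) :
    B ⊓ var {(e₁, e₂)} ≤ var {(u, v)} :=
  FIC_iff_le_var.1 ((FIC _).trans ((FIC _).trans (FIC_mono inf_le_left hu)
    (FIC_mono inf_le_right (FIC_var rfl))) ((FIC _).symm (FIC_mono inf_le_left hv)))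

/-! ### The varieties generated by Rees quotients -/

/-- The class of `p` divides the class of `w` modulo `α`. -/
def Divides (α : Con Word) (w p : Word) : Prop := ∃ a b, α w (a * p * b)

theorem mem_factors_iff_divides {α : Con Word} {w p : Word} :
    (p : α.Quotient) ∈ factors ({(w : α.Quotient)} : Set α.Quotient) ↔ Divides α w p := by
  constructor
  · rintro ⟨_, rfl, a, b, h⟩
    induction a using Con.induction_on with | H a =>
    induction b using Con.induction_on with | H b =>
    exact ⟨a, b, (Con.eq _).1 h⟩
  · rintro ⟨a, b, h⟩
    exact ⟨_, rfl, a, b, (Con.eq _).2 h⟩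

theorem FIC_varMα {α : Con Word} {w u v : Word} : FIC (varMα α w) u v ↔ ∀ φ : ℕ → Word,
    α (lift φ u) (lift φ v) ∨ (¬ Divides α w (lift φ u) ∧ ¬ Divides α w (lift φ v)) := by
  rw [varMα, FIC_generatedBy, satisfies_iff_of_surjective
    ((reesCon ({(w : α.Quotient)} : Set α.Quotient)).mk'.comp α.mk')
    (Con.mk'_surjective.comp Con.mk'_surjective)]
  refine forall_congr' fun φ => ?_
  rw [← mem_factors_iff_divides, ← mem_factors_iff_divides, ← Con.eq α]
  exact Con.eq _

theorem varM_eq_varMα_bot (w : Word) : varM w = varMα ⊥ w := by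
  have hfactors (p : Word) : p ∈ factors ({w} : Set Word) ↔ Divides ⊥ w p := by
    simp only [factors, Divides, Set.mem_singleton_iff, exists_eq_left]
    rfl
  have hFIC (u v : Word) : FIC (varM w) u v ↔ FIC (varMα ⊥ w) u v := by
    rw [FIC_varMα, varM, FIC_generatedBy, satisfies_iff_of_surjective
      (reesCon ({w} : Set Word)).mk' Con.mk'_surjective]
    simp only [← hfactors]
    exact forall_congr' fun φ => Con.eq _
  exact le_antisymm (le_of_FIC fun u v => (hFIC u v).2) (le_of_FIC fun u v => (hFIC u v).1)

theorem class_of_FIC_varMα {α : Con Word} {w u v : Word} (h : FIC (varMα α w) u v)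
    (φ : ℕ → Word) (a b : Word) (hu : α w (a * lift φ u * b)) : α w (a * lift φ v * b) := by
  rcases FIC_varMα.1 h φ with huv | ⟨hndvd, -⟩
  · exact α.trans hu (α.mul (α.mul (α.refl a) huv) (α.refl b))
  · exact absurd ⟨a, b, hu⟩ hndvd

theorem not_FIC_varMα {α : Con Word} {w u v : Word} (φ : ℕ → Word) (hu : α w (lift φ u))
    (hv : ¬ α w (lift φ v)) : ¬ FIC (varMα α w) u v := fun h =>
  hv (by simpa using class_of_FIC_varMα h φ 1 1 (by simpa using hu))

theorem FIC_varMα_of_divides {α : Con Word} {w u v : Word}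
    (h : ∀ φ : ℕ → Word, Divides α w (lift φ u) ∨ Divides α w (lift φ v) →
      α (lift φ u) (lift φ v)) : FIC (varMα α w) u v :=
  FIC_varMα.2 fun φ => or_iff_not_imp_right.2 fun hdvd =>
    h φ (by rwa [← not_or, not_not] at hdvd)

theorem FIC_varMα_FIC {V : Variety} {w u v : Word} (h : FIC V u v) :
    FIC (varMα (FIC V) w) u v :=
  FIC_varMα.2 fun φ => Or.inl (FIC_lift h φ)

/-! ### Words, occurrences of letters, scattered subwords -/

theorem toList_lift (φ : ℕ → Word) (u : Word) :
    toList (lift φ u) = (toList u).flatMap fun i => toList (φ i) := by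
  induction u using FreeMonoid.inductionOn' with
  | one => rfl
  | of_mul a u ih => simp [ih]

theorem occ_one (a : ℕ) : occ a 1 = 0 := rfl

theorem occ_of (a b : ℕ) : occ a (of b) = if b = a then 1 else 0 := by
  simp [occ, List.count_singleton]

theorem mem_iff_occ {a : ℕ} {u : Word} : a ∈ toList u ↔ 1 ≤ occ a u :=
  List.one_le_count_iff.symm

theorem occ_pow (a : ℕ) (u : Word) (n : ℕ) : occ a (u ^ n) = n * occ a u := by
  induction n with
  | zero => simp [occ_one]
  | succ n ih => rw [pow_succ, occ_mul, ih]; ring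

theorem mul_occ_le_occ_lift (φ : ℕ → Word) (a c : ℕ) (u : Word) :
    occ c u * occ a (φ c) ≤ occ a (lift φ u) := by
  induction u using FreeMonoid.inductionOn' with
  | one => simp [occ_one]
  | of_mul b u ih =>
    rw [map_mul, FreeMonoid.lift_eval_of, occ_mul, occ_mul, occ_of, add_mul]
    split_ifs with h
    · subst h
      linarith
    · linarith

theorem lift_ite_one {M : Type*} [Monoid M] (a : ℕ) (m : M) (u : Word) :
    lift (fun i => if i = a then m else 1) u = m ^ occ a u := by
  induction u using FreeMonoid.inductionOn' with
  | one => simp [occ_one]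
  | of_mul b u ih =>
    rw [map_mul, FreeMonoid.lift_eval_of, occ_mul, ih, occ_of]
    split_ifs with h
    · rw [pow_add, pow_one]
    · rw [one_mul, zero_add]

theorem eq_one_of_forall_notMem {u : Word} (h : ∀ a, a ∉ toList u) : u = 1 :=
  toList.injective (List.eq_nil_iff_forall_not_mem.2 h)

theorem toList_of_pow (m n : ℕ) : toList (of m ^ n) = List.replicate n m := by
  induction n with
  | zero => rfl
  | succ n ih => rw [pow_succ', FreeMonoid.toList_mul, ih]; rfl

theorem exists_eq_of_pow {m : ℕ} {u : Word} (h : ∀ a ∈ toList u, a = m) : ∃ i, u = of m ^ i :=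
  ⟨(toList u).length, toList.injective
    ((List.eq_replicate_iff.2 ⟨rfl, h⟩).trans (toList_of_pow _ _).symm)⟩

theorem commute_of_forall_mem_eq {u v : Word}
    (h : ∀ a ∈ toList u, ∀ b ∈ toList v, a = b) : u * v = v * u := by
  by_cases hu : ∃ m, m ∈ toList u
  · obtain ⟨m, hm⟩ := hu
    by_cases hv : ∃ n, n ∈ toList v
    · obtain ⟨n, hn⟩ := hv
      obtain ⟨i, rfl⟩ := exists_eq_of_pow fun a ha => h a ha n hn
      obtain ⟨j, rfl⟩ := exists_eq_of_pow fun b hb => (h m hm b hb).symm.trans (h m hm n hn)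
      exact (Commute.pow_pow_self _ i j).eq
    · rw [eq_one_of_forall_notMem (not_exists.1 hv), mul_one, one_mul]
  · rw [eq_one_of_forall_notMem (not_exists.1 hu), mul_one, one_mul]

/-- The word `u` is a scattered subword of `v`. -/
def IsSubword (u v : Word) : Prop := (toList u).Sublist (toList v)

instance (u v : Word) : Decidable (IsSubword u v) :=
  inferInstanceAs (Decidable ((toList u).Sublist (toList v)))

namespace IsSubword

theorem refl (u : Word) : IsSubword u u := List.Sublist.refl _

theorem one (u : Word) : IsSubword 1 u := List.nil_sublist _

theorem trans {u v w : Word} (huv : IsSubword u v) (hvw : IsSubword v w) : IsSubword u w :=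
  List.Sublist.trans huv hvw

theorem mul {u u' v v' : Word} (hu : IsSubword u u') (hv : IsSubword v v') :
    IsSubword (u * v) (u' * v') := by
  unfold IsSubword
  rw [FreeMonoid.toList_mul, FreeMonoid.toList_mul]
  exact List.Sublist.append hu hv

theorem mul_left {u v : Word} (h : IsSubword u v) (a : Word) : IsSubword u (a * v) := by
  simpa using (one a).mul h

theorem mul_right {u v : Word} (h : IsSubword u v) (b : Word) : IsSubword u (v * b) := by
  simpa using h.mul (one b)

theorem context {u v : Word} (h : IsSubword u v) (a b : Word) : IsSubword u (a * v * b) :=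
  (h.mul_left a).mul_right b

theorem occ_le {u v : Word} (h : IsSubword u v) (a : ℕ) : occ a u ≤ occ a v :=
  List.Sublist.count_le a h

theorem lift_mono {φ ψ : ℕ → Word} (h : ∀ i, IsSubword (φ i) (ψ i)) (u : Word) :
    IsSubword (lift φ u) (lift ψ u) := by
  induction u using FreeMonoid.inductionOn' with
  | one => exact refl 1
  | of_mul b u ih =>
    rw [map_mul, map_mul, FreeMonoid.lift_eval_of, FreeMonoid.lift_eval_of]
    exact (h b).mul ih

theorem lift {u v : Word} (h : IsSubword u v) (φ : ℕ → Word) :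
    IsSubword (FreeMonoid.lift φ u) (FreeMonoid.lift φ v) := by
  unfold IsSubword
  rw [toList_lift, toList_lift]
  exact List.Sublist.flatMap h _

end IsSubword

theorem of_isSubword_iff {a : ℕ} {u : Word} : IsSubword (of a) u ↔ 1 ≤ occ a u := by
  rw [← mem_iff_occ]
  exact List.singleton_sublist

theorem exists_eq_mul_of_mul {k : ℕ} {p : Word} (h : 1 ≤ occ k p) :
    ∃ a b, p = a * of k * b ∧ occ k a = 0 := by
  obtain ⟨a, b, hp, ha⟩ := List.eq_append_cons_of_mem (mem_iff_occ.2 h)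
  refine ⟨FreeMonoid.ofList a, FreeMonoid.ofList b, toList.injective ?_, List.count_eq_zero.2 ha⟩
  simpa using hp

theorem exists_eq_mul_of_mul_of_simple {k : ℕ} {p : Word} (h : occ k p = 1) :
    ∃ a b, p = a * of k * b ∧ occ k a = 0 ∧ occ k b = 0 := by
  obtain ⟨a, b, rfl, ha⟩ := exists_eq_mul_of_mul h.ge
  refine ⟨a, b, rfl, ha, ?_⟩
  rw [occ_mul, occ_mul, occ_of, if_pos rfl] at h
  omega

theorem sublist_of_cons_sublist_append {α : Type*} {k : α} {g a b : List α} (ha : k ∉ a)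
    (h : (k :: g).Sublist (a ++ b)) : (k :: g).Sublist b := by
  induction a with
  | nil => exact h
  | cons d a ih =>
    rw [List.mem_cons, not_or] at ha
    exact ih ha.2 (h.of_cons_of_ne ha.1)

theorem sublist_of_cons_sublist_append_cons {α : Type*} {k : α} {g a b : List α} (ha : k ∉ a)
    (h : (k :: g).Sublist (a ++ k :: b)) : g.Sublist b :=
  List.cons_sublist_cons.1 (sublist_of_cons_sublist_append ha h)

theorem sublist_of_concat_sublist_append_cons {α : Type*} {k : α} {f a b : List α} (hb : k ∉ b)
    (h : (f ++ [k]).Sublist (a ++ k :: b)) : f.Sublist a := by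
  rw [← List.reverse_sublist]
  refine sublist_of_cons_sublist_append_cons (b := a.reverse) (mt List.mem_reverse.1 hb) ?_
  simpa using List.reverse_sublist.2 h

theorem IsSubword.glue {k : ℕ} {p f g : Word} (hk : occ k p = 1) (hf : IsSubword (f * of k) p)
    (hg : IsSubword (of k * g) p) : IsSubword (f * of k * g) p := by
  obtain ⟨a, b, rfl, ha, hb⟩ := exists_eq_mul_of_mul_of_simple hk
  have hfa : IsSubword f a := sublist_of_concat_sublist_append_cons (b := toList b)
    (List.count_eq_zero.1 hb) (by simpa [IsSubword] using hf)
  have hgb : IsSubword g b := sublist_of_cons_sublist_append_cons (a := toList a)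
    (List.count_eq_zero.1 ha) (by simpa [IsSubword] using hg)
  exact (hfa.mul (refl _)).mul hgb

/-! ### Substitutions forced to commute by avoided subwords -/

theorem exists_mem_of_occ_lift {φ : ℕ → Word} {k : ℕ} {e : Word} (h : 1 ≤ occ k (lift φ e)) :
    ∃ c ∈ toList e, 1 ≤ occ k (φ c) := by
  rw [← mem_iff_occ, toList_lift, List.mem_flatMap] at h
  simpa only [mem_iff_occ] using h

/-- The substitution sending the letters `0`, `1`, `c` to the letters `i`, `j`, `k` and erasing
the other ones. For `c = 0` only the images `i` and `j` remain. -/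
def probe (i j c k : ℕ) (a : ℕ) : Word :=
  if a = 0 then of i else if a = 1 then of j else if a = c then of k else 1

/-- The shortest words one of which is a subword of every `a φ(e) b` such that `φ(0)` contains `i`,
`φ(1)` contains `j`, and `k` occurs outside of these images. -/
def patterns (e : Word) (k i j : ℕ) : List Word :=
  (of k * lift (probe i j 0 k) e) :: (lift (probe i j 0 k) e * of k) ::
  ((toList e).filter (2 ≤ ·)).map fun c => lift (probe i j c k) e

theorem probe_isSubword {φ : ℕ → Word} {i j c k : ℕ} (hi : 1 ≤ occ i (φ 0))
    (hj : 1 ≤ occ j (φ 1)) (hc : c = 0 ∨ 1 ≤ occ k (φ c)) (a : ℕ) :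
    IsSubword (probe i j c k a) (φ a) := by
  unfold probe
  split_ifs with h0 h1 hac
  · exact h0 ▸ of_isSubword_iff.2 hi
  · exact h1 ▸ of_isSubword_iff.2 hj
  · exact hac ▸ of_isSubword_iff.2 (hc.resolve_left (hac ▸ h0))
  · exact .one _

theorem exists_pattern_isSubword {φ : ℕ → Word} {a b e : Word} {k i j : ℕ}
    (hi : 1 ≤ occ i (φ 0)) (hj : 1 ≤ occ j (φ 1)) (h0 : 2 ≤ occ 0 e) (h1 : 2 ≤ occ 1 e)
    (hk : occ k (a * lift φ e * b) = 1) :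
    ∃ q ∈ patterns e k i j, IsSubword q (a * lift φ e * b) := by
  rw [occ_mul, occ_mul] at hk
  have hprobe : IsSubword (lift (probe i j 0 k) e) (lift φ e) :=
    .lift_mono (probe_isSubword hi hj (Or.inl rfl)) e
  rcases (by omega : 1 ≤ occ k a ∨ 1 ≤ occ k b ∨ 1 ≤ occ k (lift φ e)) with ha | hb | he
  · exact ⟨_, List.mem_cons_self, by
      simpa using ((of_isSubword_iff.2 ha).mul hprobe).mul (.one b)⟩
  · exact ⟨_, List.mem_cons_of_mem _ List.mem_cons_self, by
      simpa using ((IsSubword.one a).mul hprobe).mul (of_isSubword_iff.2 hb)⟩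
  · obtain ⟨c, hce, hkc⟩ := exists_mem_of_occ_lift he
    have hc : 2 ≤ c := by
      have hmul := mul_occ_le_occ_lift φ k c e
      by_contra! hlt
      rcases (by omega : c = 0 ∨ c = 1) with rfl | rfl <;> nlinarith
    refine ⟨_, List.mem_cons_of_mem _ (List.mem_cons_of_mem _ (List.mem_map_of_mem
      (List.mem_filter.2 ⟨hce, decide_eq_true hc⟩))), ?_⟩
    exact (IsSubword.lift_mono (probe_isSubword hi hj (Or.inr hkc)) e).context a b

/-- The letters `0` and `1` are multiple in `e`, and a word which avoids the subwords from `F`, has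
the simple letter `k` and no multiple letters except `0` and `1`, and contains `φ(e)`, is too short
for `φ(0)` and `φ(1)` to contain distinct letters: each pattern has a subword from `F`. -/
def Blocked (F : List Word) (k : ℕ) (e : Word) : Prop :=
  (2 ≤ occ 0 e ∧ 2 ≤ occ 1 e) ∧
    ∀ q ∈ patterns e k 0 1 ++ patterns e k 1 0, ∃ f ∈ F, IsSubword f q

instance (F : List Word) (k : ℕ) (e : Word) : Decidable (Blocked F k e) :=
  inferInstanceAs (Decidable (_ ∧ _))

theorem commute_of_blocked {φ : ℕ → Word} {p a b e : Word} {k : ℕ} {F : List Word}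
    (hp : p = a * lift φ e * b) (hmul : ∀ c, 2 ≤ occ c p → c = 0 ∨ c = 1) (hk : occ k p = 1)
    (hF : ∀ f ∈ F, ¬ IsSubword f p) (hB : Blocked F k e) : φ 0 * φ 1 = φ 1 * φ 0 := by
  subst hp
  obtain ⟨⟨h0, h1⟩, hB⟩ := hB
  have hletters (d : ℕ) (hd : 2 ≤ occ d e) (c : ℕ) (hc : 1 ≤ occ c (φ d)) : c = 0 ∨ c = 1 := by
    refine hmul c ?_
    have := mul_occ_le_occ_lift φ c d e
    rw [occ_mul, occ_mul]
    nlinarith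
  have havoid (i j : ℕ) (hpat : patterns e k i j ⊆ patterns e k 0 1 ++ patterns e k 1 0)
      (hi : 1 ≤ occ i (φ 0)) (hj : 1 ≤ occ j (φ 1)) : False := by
    obtain ⟨q, hq, hqp⟩ := exists_pattern_isSubword (a := a) (b := b) hi hj h0 h1 hk
    obtain ⟨f, hf, hfq⟩ := hB q (hpat hq)
    exact hF f hf (hfq.trans hqp)
  refine commute_of_forall_mem_eq fun i hi j hj => ?_
  rw [mem_iff_occ] at hi hj
  rcases hletters 0 h0 i hi with rfl | rfl <;> rcases hletters 1 h1 j hj with rfl | rfl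
  · rfl
  · exact (havoid 0 1 (List.subset_append_left _ _) hi hj).elim
  · exact (havoid 1 0 (List.subset_append_right _ _) hi hj).elim
  · rfl

/-! ### Congruences preserving simple and multiple letters -/

/-- The words related by `α` have the same simple and the same multiple letters. -/
def PreservesSimple (α : Con Word) : Prop :=
  ∀ p q, α p q → ∀ a, min (occ a p) 2 = min (occ a q) 2

theorem preservesSimple_bot : PreservesSimple ⊥ := by
  rintro p _ rfl a
  rfl

theorem preservesSimple_gam : PreservesSimple gam := by
  rintro p q ⟨hsim, hsquash⟩ a
  have hone : occ a p = 1 ↔ occ a q = 1 := Set.ext_iff.1 hsim a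
  have hzero : occ a p = 0 ↔ occ a q = 0 := by rw [occ_eq_zero, occ_eq_zero, hsquash]
  omega

theorem PreservesSimple.mono {α β : Con Word} (hβ : PreservesSimple β) (h : α ≤ β) :
    PreservesSimple α :=
  fun _ _ hpq => hβ _ _ (h hpq)

theorem lam_le_gam : lam ≤ gam := fun _ _ h => h.1

theorem preservesSimple_lam : PreservesSimple lam := preservesSimple_gam.mono lam_le_gam

theorem occ_reverse (a : ℕ) (p : Word) : occ a p.reverse = occ a p := List.count_reverse

theorem PreservesSimple.dualCon {α : Con Word} (hα : PreservesSimple α) :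
    PreservesSimple (dualCon α) := by
  intro p q hpq a
  rw [← occ_reverse, ← occ_reverse a q]
  exact hα _ _ hpq a

theorem PreservesSimple.FIC_varMα {α : Con Word} (hα : PreservesSimple α) {w : Word} {k : ℕ}
    (hk : occ k w = 1) : PreservesSimple (FIC (varMα α w)) := by
  obtain ⟨b, c, hw, hb, hc⟩ := exists_eq_mul_of_mul_of_simple hk
  subst hw
  have hzero (p q : Word) (h : FIC (varMα α (b * of k * c)) p q) (a : ℕ) (ha : occ a p = 0) :
      occ a q = 0 := by
    have hq := class_of_FIC_varMα h (fun i => if i = a then of k else 1) (b * of k * c) 1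
    simp only [lift_ite_one, ha, pow_zero, mul_one] at hq
    have hocc := hα _ _ (hq (α.refl _)) k
    simp only [occ_mul, occ_of, occ_pow, if_true] at hocc
    omega
  have hone (p q : Word) (h : FIC (varMα α (b * of k * c)) p q) (a : ℕ) (ha : occ a p = 1) :
      occ a q = 1 := by
    have hq := class_of_FIC_varMα h (fun i => if i = a then of k else 1) b c
    simp only [lift_ite_one, ha, pow_one] at hq
    have hocc := hα _ _ (hq (α.refl _)) k
    simp only [occ_mul, occ_of, occ_pow, if_true] at hocc
    omega
  intro p q h a
  have := hzero p q h a
  have := hzero q p ((FIC _).symm h) a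
  have := hone p q h a
  have := hone q p ((FIC _).symm h) a
  omega

theorem PreservesSimple.two_le_occ {α : Con Word} (hα : PreservesSimple α) {w u : Word}
    {φ : ℕ → Word} (h : Divides α w (lift φ u)) {c a : ℕ} (hc : 2 ≤ occ c u)
    (ha : a ∈ toList (φ c)) : 2 ≤ occ a w := by
  obtain ⟨b, d, h⟩ := h
  have hocc := hα _ _ h a
  have hmul := mul_occ_le_occ_lift φ a c u
  rw [mem_iff_occ] at ha
  rw [occ_mul, occ_mul] at hocc
  have : 2 ≤ occ c u * occ a (φ c) := by nlinarith
  omega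

/-! ### Permuting the letters `0` and `1` -/

theorem lift_foldr {M : Type*} [Monoid M] {φ : ℕ → M} {f : ℕ → List ℕ → List ℕ}
    (hf : ∀ a l, lift φ (FreeMonoid.ofList (f a l)) = φ a * lift φ (FreeMonoid.ofList l))
    (w : Word) : lift φ (FreeMonoid.ofList ((toList w).foldr f [])) = lift φ w := by
  induction w using FreeMonoid.inductionOn' with
  | one => rfl
  | of_mul b u ih =>
    rw [FreeMonoid.toList_mul, FreeMonoid.toList_of, List.singleton_append, List.foldr_cons, hf,
      ih, map_mul, FreeMonoid.lift_eval_of]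

/-- Put the letter `a` in front of `l`, and move it, if `a = 1`, behind the initial block of
letters `0`. -/
def swapStep (a : ℕ) (l : List ℕ) : List ℕ :=
  if a = 1 then l.takeWhile (· = 0) ++ 1 :: l.dropWhile (· = 0) else a :: l

/-- The words `u` and `v` differ only by the order of the letters `0` and `1` within maximal blocks
of these letters, both of which are multiple in `u`. -/
def SwapEquiv (u v : Word) : Prop :=
  (2 ≤ occ 0 u ∧ 2 ≤ occ 1 u) ∧ (toList u).foldr swapStep [] = (toList v).foldr swapStep []

instance (u v : Word) : Decidable (SwapEquiv u v) :=
  inferInstanceAs (Decidable (_ ∧ _))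

theorem lift_swapStep {M : Type*} [Monoid M] {φ : ℕ → M} (h : φ 0 * φ 1 = φ 1 * φ 0) (a : ℕ)
    (l : List ℕ) :
    lift φ (FreeMonoid.ofList (swapStep a l)) = φ a * lift φ (FreeMonoid.ofList l) := by
  unfold swapStep
  split_ifs with ha
  · subst ha
    obtain ⟨i, hi⟩ := exists_eq_of_pow (m := 0)
      (u := FreeMonoid.ofList (l.takeWhile (· = 0))) fun a ha => by
        simpa using List.mem_takeWhile_imp ha
    conv_rhs => rw [← List.takeWhile_append_dropWhile (p := (· = 0)) (l := l)]
    simp only [FreeMonoid.ofList_append, FreeMonoid.ofList_cons, map_mul, hi, map_pow,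
      FreeMonoid.lift_eval_of, ← mul_assoc]
    rw [(Commute.pow_left h i).eq]
  · simp

theorem SwapEquiv.lift_eq {M : Type*} [Monoid M] {u v : Word} (huv : SwapEquiv u v) {φ : ℕ → M}
    (h : φ 0 * φ 1 = φ 1 * φ 0) : lift φ u = lift φ v := by
  rw [← lift_foldr (lift_swapStep h) u, huv.2, lift_foldr (lift_swapStep h)]

theorem SwapEquiv.occ_eq {u v : Word} (huv : SwapEquiv u v) (a : ℕ) : occ a u = occ a v := by
  have hlift := huv.lift_eq (φ := fun i => if i = a then of 0 else 1) (by split_ifs <;> simp)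
  rw [lift_ite_one, lift_ite_one] at hlift
  simpa [occ_pow, occ_of] using congrArg (occ 0) hlift

theorem FIC_of_swapEquiv {α : Con Word} (hα : PreservesSimple α) {w u v : Word}
    (hw : ∀ a ∈ toList w, 2 ≤ occ a w → a = 0) (huv : SwapEquiv u v) : FIC (varMα α w) u v := by
  have hmul {p : Word} (h0 : 2 ≤ occ 0 p) (h1 : 2 ≤ occ 1 p) {φ : ℕ → Word}
      (h : Divides α w (lift φ p)) : φ 0 * φ 1 = φ 1 * φ 0 := by
    have hzero {c a : ℕ} (hc : 2 ≤ occ c p) (ha : a ∈ toList (φ c)) : a = 0 := by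
      have := hα.two_le_occ h hc ha
      exact hw a (mem_iff_occ.2 (by omega)) this
    exact commute_of_forall_mem_eq fun a ha b hb => (hzero h0 ha).trans (hzero h1 hb).symm
  refine FIC_varMα_of_divides fun φ h => ?_
  rw [huv.lift_eq (h.elim (hmul huv.1.1 huv.1.2)
    (hmul (huv.occ_eq 0 ▸ huv.1.1) (huv.occ_eq 1 ▸ huv.1.2)))]
  exact α.refl _

theorem nonmodular_of_swap {α : Con Word} {w : Word} {B : Variety} {u v e₁ e₂ : Word} (k : ℕ)
    (F : List Word) (hα : PreservesSimple α) {m : ℕ} (hm : occ m w = 1)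
    (hw : ∀ a ∈ toList w, 2 ≤ occ a w → a = 0) (huv : SwapEquiv u v) (he : SwapEquiv e₁ e₂)
    (hu : FIC B u e₁) (hv : FIC B v e₂) (hV : ¬ FIC B u v)
    (hF : ∀ p, FIC (varMα α w) u p → FIC B u p → ∀ f ∈ F, ¬ IsSubword f p)
    (hk : occ k u = 1) (hmul : ∀ a ∈ toList u, 2 ≤ occ a u → a = 0 ∨ a = 1)
    (h₁ : Blocked F k e₁) (h₂ : Blocked F k e₂) :
    HasNonmodularSubvarietyLattice (varMα α w ⊔ B) := by
  refine nonmodular_of_trivial_instances (FIC_of_swapEquiv hα hw he) (FIC_of_swapEquiv hα hw huv)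
    (inf_var_le_var hu hv) (fun h => hV (FIC_sup.1 h).2) fun φ a b h => he.lift_eq ?_
  have hcomm {p e : Word} (hp : FIC (varMα α w ⊔ B) u p) (hpe : p = a * lift φ e * b)
      (hB : Blocked F k e) : φ 0 * φ 1 = φ 1 * φ 0 := by
    obtain ⟨hpA, hpB⟩ := FIC_sup.1 hp
    have hocc := hα.FIC_varMα hm _ _ hpA
    refine commute_of_blocked hpe (fun c hc => ?_) (by have := hocc k; omega) (hF p hpA hpB) hB
    have := hocc c
    exact hmul c (mem_iff_occ.2 (by omega)) (by omega)
  exact h.elim (fun h => hcomm h rfl h₁) fun h => hcomm h rfl h₂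

theorem not_isSubword_of_class {α : Con Word} {w u p f : Word} (h : FIC (varMα α w) u p)
    (φ : ℕ → Word) (hu : α w (lift φ u)) (hf : ∀ q, α w q → ¬ IsSubword (lift φ f) q) :
    ¬ IsSubword f p :=
  fun hs => hf _ (by simpa using class_of_FIC_varMα h φ 1 1 (by simpa using hu)) (hs.lift φ)

/-! ### The varieties `𝐌(w)` -/

/-- The substitution erasing the letters from `l`. -/
def erase (l : List ℕ) (i : ℕ) : Word := if i ∈ l then 1 else of i

/-- The substitution erasing the letters outside of `l` and renaming the letters from `l` to
`0, 1, …` in this order. -/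
def restrict (l : List ℕ) (i : ℕ) : Word := if i ∈ l then of (l.idxOf i) else 1

theorem lift_erase {M : Type*} [Monoid M] {φ : ℕ → M} {l : List ℕ} (h : ∀ c ∈ l, φ c = 1)
    (u : Word) : lift φ (lift (erase l) u) = lift φ u := by
  rw [FreeMonoid.hom_map_lift]
  congr 2
  funext i
  rw [Function.comp_apply, erase]
  split_ifs with hi
  · rw [map_one, h i hi]
  · rw [FreeMonoid.lift_eval_of]

theorem FIC_varM_pin {w u p : Word} (h : FIC (varM w) u p) {φ : ℕ → Word} {a b : Word}
    (hu : w = a * lift φ u * b) : w = a * lift φ p * b := by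
  rw [varM_eq_varMα_bot] at h
  exact class_of_FIC_varMα h φ a b hu

theorem eq_one_of_occ_lt {w u a b : Word} {φ : ℕ → Word} {c n : ℕ}
    (hw : ∀ d ∈ toList w, occ d w ≤ n) (hc : n < occ c u) (h : w = a * lift φ u * b) :
    φ c = 1 := by
  refine eq_one_of_forall_notMem fun d hd => ?_
  rw [mem_iff_occ] at hd
  have hmul := mul_occ_le_occ_lift φ d c u
  have hle : occ c u ≤ occ c u * occ d (φ c) := Nat.le_mul_of_pos_right _ hd
  have hocc : occ d w = occ d a + occ d (lift φ u) + occ d b := by rw [h, occ_mul, occ_mul]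
  have := hw d
  rw [mem_iff_occ] at this
  omega

theorem FIC_varM_of_erase {w u v : Word} (c n : ℕ) (hw : ∀ d ∈ toList w, occ d w ≤ n)
    (hu : n < occ c u) (hv : n < occ c v) (h : lift (erase [c]) u = lift (erase [c]) v) :
    FIC (varM w) u v := by
  rw [varM_eq_varMα_bot]
  refine FIC_varMα_of_divides fun φ hd => ?_
  have hφ : φ c = 1 := by
    rcases hd with ⟨a, b, hab⟩ | ⟨a, b, hab⟩
    · exact eq_one_of_occ_lt hw hu hab
    · exact eq_one_of_occ_lt hw hv hab
  have hφ' : ∀ d ∈ [c], φ d = 1 := by simpa using hφ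
  rw [← lift_erase hφ', h, lift_erase hφ']
  exact (⊥ : Con Word).refl _

theorem FIC_xyx_of_erase {u v : Word} (hu : 3 ≤ occ 0 u) (hv : 3 ≤ occ 0 v)
    (h : lift (erase [0]) u = lift (erase [0]) v) : FIC (varM (x * y * x)) u v :=
  FIC_varM_of_erase 0 2 (by decide) hu hv h

theorem FIC_xyx_sq : FIC (varM (x * y * x)) (x ^ 2) (x ^ 3) := by
  have hsquarefree (l : List ℕ) (h : l ++ l <:+: [0, 1, 0]) : l = [] := by
    match l with
    | [] => rfl
    | [c] =>
      have hc : c = 0 ∨ c = 1 := by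
        simpa [or_comm] using h.subset (List.mem_cons_self (a := c))
      rcases hc with rfl | rfl <;> revert h <;> decide
    | _ :: _ :: _ =>
      have := h.length_le
      simp only [List.length_append, List.length_cons, List.length_nil] at this
      omega
  have hone (X a b : Word) (h : x * y * x = a * (X * X) * b) : X = 1 :=
    toList.injective (hsquarefree _ ⟨toList a, toList b, (congrArg toList h).symm⟩)
  rw [varM_eq_varMα_bot]
  refine FIC_varMα_of_divides fun φ hd => ?_
  simp only [map_pow] at hd ⊢
  have hφ : lift φ x = 1 := by
    rcases hd with ⟨a, b, h⟩ | ⟨a, b, h⟩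
    · exact hone _ a b (h.trans (by simp only [pow_succ, pow_zero, one_mul]))
    · exact hone _ a (lift φ x * b)
        (h.trans (by simp only [pow_succ, pow_zero, one_mul, mul_assoc]))
  rw [hφ, one_pow, one_pow]
  exact (⊥ : Con Word).refl _

theorem FIC_xyx_cube (a b : Word) : FIC (varM (x * y * x)) (a * x ^ 2 * b) (a * x ^ 3 * b) :=
  (FIC _).mul ((FIC _).mul ((FIC _).refl a) FIC_xyx_sq) ((FIC _).refl b)

theorem not_isSubword_of_FIC_varM {w u p f a b : Word} {φ : ℕ → Word} (h : FIC (varM w) u p)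
    (hu : w = a * lift φ u * b) (hf : ¬ IsSubword (lift φ f) w) : ¬ IsSubword f p := fun hs =>
  hf (by rw [FIC_varM_pin h hu]; exact (hs.lift φ).context a b)

theorem FIC_varM_restrict {w u p : Word} (h : FIC (varM w) u p) (l : List ℕ)
    (hu : lift (restrict l) u = w) : lift (restrict l) p = w := by
  have hpin := FIC_varM_pin h (φ := restrict l) (a := 1) (b := 1) (by rw [one_mul, mul_one, hu])
  rwa [one_mul, mul_one, eq_comm] at hpin

theorem not_isSubword_of_FIC_restrict {w u p f : Word} (h : FIC (varM w) u p) (l : List ℕ)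
    (hu : lift (restrict l) u = w) (hf : ¬ IsSubword (lift (restrict l) f) w) : ¬ IsSubword f p :=
  fun hs => hf (by rw [← FIC_varM_restrict h l hu]; exact hs.lift _)

theorem not_isSubword_of_varMα {α : Con Word} {w u p f : Word}
    (hα : α ≤ FIC (varM (x * y * x))) (h : FIC (varMα α w) u p) (φ : ℕ → Word)
    (hu : α w (lift φ u)) (l : List ℕ) (hw : lift (restrict l) w = x * y * x)
    (hf : ¬ IsSubword (lift (restrict l) (lift φ f)) (x * y * x)) : ¬ IsSubword f p :=
  not_isSubword_of_class h φ hu fun _ hq => not_isSubword_of_FIC_restrict (hα hq) l hw hf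

/-! ### The congruences `γ` and `λ` -/

theorem gam_iff {u v : Word} : gam u v ↔
    squash u = squash v ∧ ∀ a ∈ toList u, occ a u = 1 ↔ occ a v = 1 := by
  refine ⟨fun h => ⟨h.2, fun a _ => Set.ext_iff.1 h.1 a⟩, fun ⟨hsquash, hocc⟩ =>
    ⟨Set.ext fun a => ?_, hsquash⟩⟩
  by_cases ha : a ∈ toList u
  · exact hocc a ha
  · have hu : occ a u = 0 := List.count_eq_zero.2 ha
    have hv : occ a v = 0 := by rwa [occ_eq_zero, ← hsquash, ← occ_eq_zero]
    simp [sim, hu, hv]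

instance (u v : Word) : Decidable (gam u v) := decidable_of_iff' _ gam_iff

instance (a : ℕ) (w : Word) : Decidable (FirstTwoAdjacent a w) :=
  inferInstanceAs (Decidable ([a, a] <+: (toList w).dropWhile (· != a)))

theorem lam_iff {u v : Word} : lam u v ↔ gam u v ∧
    ∀ a ∈ toList u, 2 ≤ occ a u → (FirstTwoAdjacent a u ↔ FirstTwoAdjacent a v) :=
  and_congr_right fun _ => ⟨fun h a _ => h a, fun h a ha => h a (mem_iff_occ.2 (by omega)) ha⟩

instance (u v : Word) : Decidable (lam u v) := decidable_of_iff' _ lam_iff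

theorem sqStep_sublist (a : ℕ) (l : List ℕ) : l.Sublist (sqStep a l) := by
  unfold sqStep
  split_ifs
  · exact List.Sublist.refl _
  · exact List.sublist_cons_self a l

theorem sqStep_mono (a : ℕ) {l m : List ℕ} (h : l.Sublist m) :
    (sqStep a l).Sublist (sqStep a m) := by
  by_cases hl : l.head? = some a
  · rw [sqStep, if_pos hl]
    exact h.trans (sqStep_sublist a m)
  by_cases hm : m.head? = some a
  · obtain ⟨m, rfl⟩ : ∃ m', m = a :: m' := List.head?_eq_some_iff.1 hm
    rw [sqStep, sqStep, if_neg hl, if_pos hm]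
    rcases List.sublist_cons_iff.1 h with h | ⟨r, rfl, -⟩
    · exact h.cons_cons a
    · exact absurd rfl hl
  · rw [sqStep, sqStep, if_neg hl, if_neg hm]
    exact h.cons_cons a

theorem IsSubword.squash_sublist {f p : Word} (h : IsSubword f p) :
    (squash f).Sublist (squash p) := by
  rw [squash_eq, squash_eq]
  unfold IsSubword at h
  generalize toList f = l at *
  generalize toList p = m at *
  induction h with
  | slnil => exact List.Sublist.refl _
  | cons a _ ih => exact ih.trans (sqStep_sublist a _)
  | cons_cons a _ ih => exact sqStep_mono a ih

theorem not_isSubword_of_squash {w p f : Word} (h : squash w = squash p)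
    (hf : ¬ (squash f).Sublist (squash w)) : ¬ IsSubword f p :=
  fun hs => hf (h ▸ hs.squash_sublist)

theorem sublist_squash_of_not_firstTwoAdjacent {p : Word} {a b : ℕ}
    (ha : ¬ FirstTwoAdjacent a p) (hab : a ≠ b) (h : IsSubword (of a * of a * of b) p) :
    [a, a, b].Sublist (squash p) := by
  obtain ⟨c, d, rfl, hc⟩ := exists_eq_mul_of_mul (k := a) (of_isSubword_iff.1
    (IsSubword.trans (v := of a * of a * of b) (by simp [IsSubword]) h))
  have hc' : a ∉ toList c := List.count_eq_zero.1 hc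
  have hd : [a, b].Sublist (toList d) :=
    sublist_of_cons_sublist_append_cons hc' (by simpa [IsSubword] using h)
  have hprefix : ¬ [a] <+: toList d := by
    simpa [FirstTwoAdjacent, dropWhile_of_notMem hc'] using ha
  obtain ⟨i, r, hr⟩ : ∃ i r, toList d = i :: r :=
    List.exists_cons_of_ne_nil fun hnil => by simp [hnil] at hd
  have hi : i ≠ a := by
    rintro rfl
    exact hprefix (hr ▸ by simp)
  have hsub : IsSubword (FreeMonoid.ofList [a, i, a, b]) (c * of a * d) := by
    have : [i, a, b].Sublist (toList d) := hr ▸ ((hr ▸ hd).of_cons_of_ne hi.symm).cons_cons i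
    simpa [IsSubword] using (this.cons_cons a).trans (List.sublist_append_right (toList c) _)
  have hsquash : squash (FreeMonoid.ofList [a, i, a, b]) = [a, i, a, b] := by
    simp [squash_eq, sqStep, hab.symm, hi, hi.symm]
  exact ((List.sublist_cons_self i [a, b]).cons_cons a).trans (hsquash ▸ hsub.squash_sublist)

theorem not_isSubword_of_lam {w p : Word} (h : lam w p) {a b : ℕ} (ha : 2 ≤ occ a w)
    (ha' : ¬ FirstTwoAdjacent a w) (hab : a ≠ b) (hs : ¬ [a, a, b].Sublist (squash w)) :
    ¬ IsSubword (of a * of a * of b) p := fun hsub =>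
  hs (h.1.2 ▸ sublist_squash_of_not_firstTwoAdjacent (mt (h.2 a ha).2 ha') hab hsub)

theorem not_isSubword_of_varMα_gam {u p : Word} (k : ℕ) (hk : k ≠ 0)
    (h : FIC (varMα gam (x ^ 2 * y)) u p) (hu : gam (x ^ 2 * y) (lift (restrict [0, k]) u)) :
    ¬ IsSubword (of k * x) p := by
  refine not_isSubword_of_class h _ hu fun q hq => not_isSubword_of_squash hq.2 ?_
  have hf : lift (restrict [0, k]) (of k * x) = y * x := by
    simp [x, y, restrict, hk.symm]
  rw [hf]
  decide

theorem not_isSubword_of_varMα_lam {u p : Word} (k : ℕ) (hk : k ≠ 0)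
    (h : FIC (varMα lam (x * y * x)) u p) (hu : lam (x * y * x) (lift (restrict [0, k]) u)) :
    ¬ IsSubword (x * x * of k) p := by
  refine not_isSubword_of_class h _ hu fun q hq => ?_
  have := not_isSubword_of_lam hq (a := 0) (b := 1) (by decide) (by decide) (by decide) (by decide)
  simpa [x, restrict, hk.symm, List.idxOf_cons] using this

/-! ### Identities changing exponents -/

/-- The congruence relating the words with the same reduced form. -/
def sqCon : Con Word where
  r u v := squash u = squash v
  iseqv := ⟨fun _ => rfl, fun h => h.symm, fun h h' => h.trans h'⟩
  mul' := fun h h' => squash_mul h h'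

theorem squash_pow (m i : ℕ) : squash (of m ^ (i + 1)) = [m] := by
  rw [squash_eq, toList_of_pow]
  induction i with
  | zero => rfl
  | succ i ih => rw [List.replicate_succ, List.foldr_cons, ih]; simp [sqStep]

theorem lam_mul_pow {m : ℕ} {p : Word} (h : 1 ≤ occ m p) (i j : ℕ) :
    lam (p * of m ^ (i + 1)) (p * of m ^ (j + 1)) := by
  have hsquash : squash (of m ^ (i + 1)) = squash (of m ^ (j + 1)) :=
    (squash_pow m i).trans (squash_pow m j).symm
  refine ⟨⟨Set.ext fun a => ?_, squash_mul rfl hsquash⟩, fun a ha => ?_⟩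
  · simp only [sim, Set.mem_ofPred_eq, occ_mul, occ_pow, occ_of]
    split_ifs with hm
    · subst hm; omega
    · omega
  · have hp : occ a p ≠ 0 := by
      intro hp
      have hm : ¬ m = a := by rintro rfl; omega
      simp [occ_mul, occ_pow, occ_of, hm, hp] at ha
    simp only [firstTwoAdjacent_mul, hsquash, hp, false_and, false_or]

theorem lam_lift_sq {c : Word} (hc : 1 ≤ occ 0 c) (d : Word) {φ : ℕ → Word} {m i : ℕ}
    (hφ : φ 0 = of m ^ i) : lam (lift φ (c * x * d)) (lift φ (c * x ^ 2 * d)) := by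
  simp only [map_mul, map_pow, x, FreeMonoid.lift_eval_of]
  refine lam.mul ?_ (lam.refl _)
  rcases i with _ | i
  · simpa [hφ] using lam.refl _
  · have hm : 1 ≤ occ m (φ 0) := by simp [hφ, occ_pow, occ_of]
    have hlift : 1 ≤ occ m (lift φ c) :=
      (Nat.mul_le_mul hc hm).trans (mul_occ_le_occ_lift φ m 0 c)
    have hexp : (i + 1) * 2 = (2 * i + 1) + 1 := by ring
    rw [hφ, ← pow_mul, hexp]
    exact lam_mul_pow hlift i (2 * i + 1)

/-- Put the letter `a` in front of `l`, merging adjacent letters `0`. -/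
def collapseStep (a : ℕ) (l : List ℕ) : List ℕ :=
  if a = 0 ∧ l.head? = some 0 then l else a :: l

/-- The words `u` and `v` differ only by the positive exponents of the letter `0`, which occurs at
least three times in both words. -/
def CollapseEquiv (u v : Word) : Prop :=
  (3 ≤ occ 0 u ∧ 3 ≤ occ 0 v) ∧ (toList u).foldr collapseStep [] = (toList v).foldr collapseStep []

instance (u v : Word) : Decidable (CollapseEquiv u v) :=
  inferInstanceAs (Decidable (_ ∧ _))

theorem lift_collapseStep {M : Type*} [Monoid M] {φ : ℕ → M} (h : φ 0 * φ 0 = φ 0) (a : ℕ)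
    (l : List ℕ) :
    lift φ (FreeMonoid.ofList (collapseStep a l)) = φ a * lift φ (FreeMonoid.ofList l) := by
  unfold collapseStep
  split_ifs with ha
  · obtain ⟨rfl, hl⟩ := ha
    obtain ⟨l, rfl⟩ : ∃ l', l = 0 :: l' := List.head?_eq_some_iff.1 hl
    simp [← mul_assoc, h]
  · simp

theorem CollapseEquiv.lift_eq {M : Type*} [Monoid M] {u v : Word} (huv : CollapseEquiv u v)
    {φ : ℕ → M} (h : φ 0 * φ 0 = φ 0) : lift φ u = lift φ v := by
  rw [← lift_foldr (lift_collapseStep h) u, huv.2, lift_foldr (lift_collapseStep h)]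

theorem CollapseEquiv.FIC_xyx {u v : Word} (huv : CollapseEquiv u v) :
    FIC (varM (x * y * x)) u v :=
  FIC_xyx_of_erase huv.1.1 huv.1.2 (huv.lift_eq rfl)

theorem CollapseEquiv.occ_lift_eq {u v : Word} (huv : CollapseEquiv u v) {φ : ℕ → Word} {a : ℕ}
    (ha : occ a (φ 0) = 0) : occ a (lift φ u) = occ a (lift φ v) := by
  have hlift := huv.lift_eq (φ := lift (fun i => if i = a then of 0 else 1) ∘ φ)
    (by simp [lift_ite_one, ha])
  rw [← FreeMonoid.hom_map_lift, ← FreeMonoid.hom_map_lift, lift_ite_one, lift_ite_one] at hlift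
  simpa [occ_pow, occ_of] using congrArg (occ 0) hlift

theorem CollapseEquiv.squash_lift_eq {u v : Word} (huv : CollapseEquiv u v) {φ : ℕ → Word}
    {m i : ℕ} (hφ : φ 0 = of m ^ i) : squash (lift φ u) = squash (lift φ v) := by
  have hidem : sqCon.mk' (φ 0) * sqCon.mk' (φ 0) = sqCon.mk' (φ 0) := by
    rw [← map_mul, hφ, ← pow_add]
    rcases i with _ | i
    · rfl
    · exact (Con.eq sqCon).2 ((squash_pow m (i + 1 + i)).trans (squash_pow m i).symm)
  refine (Con.eq sqCon).1 (?_ : sqCon.mk' (lift φ u) = sqCon.mk' (lift φ v))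
  rw [FreeMonoid.hom_map_lift, FreeMonoid.hom_map_lift]
  exact huv.lift_eq hidem

theorem CollapseEquiv.gam_lift {u v : Word} (huv : CollapseEquiv u v) {φ : ℕ → Word} {m i : ℕ}
    (hφ : φ 0 = of m ^ i) : gam (lift φ u) (lift φ v) := by
  refine ⟨Set.ext fun a => ?_, huv.squash_lift_eq hφ⟩
  change occ a _ = 1 ↔ occ a _ = 1
  rcases Nat.eq_zero_or_pos (occ a (φ 0)) with ha | ha
  · rw [huv.occ_lift_eq ha]
  · obtain ⟨⟨hu, hv⟩, -⟩ := huv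
    have hmul_u := mul_occ_le_occ_lift φ a 0 u
    have hmul_v := mul_occ_le_occ_lift φ a 0 v
    have hne_u : occ a (lift φ u) ≠ 1 := by nlinarith
    have hne_v : occ a (lift φ v) ≠ 1 := by nlinarith
    exact iff_of_false hne_u hne_v

/-- The letter `1` occurs exactly twice in the words equal to `w` in `𝐌(xyx)`, since `w` restricted
to `1` and `k` is `1k1`. -/
theorem exists_eq_pow_of_divides {α : Con Word} (hα : α ≤ FIC (varM (x * y * x))) {w u : Word}
    (k : ℕ) (hk : lift (restrict [1, k]) w = x * y * x)
    (hw : ∀ a ∈ toList w, 2 ≤ occ a w → a = 0 ∨ a = 1) (hu : 3 ≤ occ 0 u) {φ : ℕ → Word}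
    (h : Divides α w (lift φ u)) : ∃ i, φ 0 = of 0 ^ i := by
  refine exists_eq_of_pow fun a ha => ?_
  obtain ⟨b, c, h⟩ := h
  have hocc : 3 ≤ occ a (b * lift φ u * c) := by
    have := mul_occ_le_occ_lift φ a 0 u
    rw [mem_iff_occ] at ha
    rw [occ_mul, occ_mul]
    nlinarith
  have hpres : PreservesSimple (FIC (varM (x * y * x))) :=
    varM_eq_varMα_bot _ ▸ preservesSimple_bot.FIC_varMα (k := 1) (by decide)
  have := hpres _ _ (hα h) a
  refine (hw a (mem_iff_occ.2 (by omega)) (by omega)).resolve_right ?_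
  rintro rfl
  refine not_isSubword_of_FIC_restrict (hα h) [1, k] hk (f := of 1 ^ 3) ?_
    (by rwa [IsSubword, toList_of_pow, List.replicate_sublist_iff])
  simp only [map_pow, FreeMonoid.lift_eval_of, restrict, List.mem_cons, true_or, if_true,
    List.idxOf_cons_self]
  decide

theorem gam'_le_FIC_xyx : gam' ≤ FIC (varM (x * y * x)) := inf_le_right

theorem lam'_le_FIC_xyx : lam' ≤ FIC (varM (x * y * x)) := inf_le_right

theorem FIC_varMα_gam' {w u v : Word} (k : ℕ) (hk : lift (restrict [1, k]) w = x * y * x)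
    (hw : ∀ a ∈ toList w, 2 ≤ occ a w → a = 0 ∨ a = 1) (huv : CollapseEquiv u v) :
    FIC (varMα gam' w) u v := by
  refine FIC_varMα_of_divides fun φ h => ?_
  obtain ⟨i, hi⟩ : ∃ i, φ 0 = of 0 ^ i :=
    h.elim (exists_eq_pow_of_divides gam'_le_FIC_xyx k hk hw huv.1.1)
      (exists_eq_pow_of_divides gam'_le_FIC_xyx k hk hw huv.1.2)
  exact ⟨huv.gam_lift hi, FIC_lift huv.FIC_xyx φ⟩

theorem FIC_varMα_lam' {w c d : Word} (k : ℕ) (hk : lift (restrict [1, k]) w = x * y * x)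
    (hw : ∀ a ∈ toList w, 2 ≤ occ a w → a = 0 ∨ a = 1) (hc : 1 ≤ occ 0 c)
    (hcd : CollapseEquiv (c * x * d) (c * x ^ 2 * d)) :
    FIC (varMα lam' w) (c * x * d) (c * x ^ 2 * d) := by
  refine FIC_varMα_of_divides fun φ h => ?_
  obtain ⟨i, hi⟩ : ∃ i, φ 0 = of 0 ^ i :=
    h.elim (exists_eq_pow_of_divides lam'_le_FIC_xyx k hk hw hcd.1.1)
      (exists_eq_pow_of_divides lam'_le_FIC_xyx k hk hw hcd.1.2)
  exact ⟨lam_lift_sq hc d hi, FIC_lift hcd.FIC_xyx φ⟩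

theorem isSubword_or_of_square {X a b c : Word} {i j k : ℕ} (hi : 1 ≤ occ i X)
    (hj : 1 ≤ occ j X) (hk : occ k (a * X * b * X * c) = 1) :
    IsSubword (of k * of i) (a * X * b * X * c) ∨
      IsSubword (of j * of j * of k) (a * X * b * X * c) := by
  simp only [occ_mul] at hk
  have hiX := of_isSubword_iff.2 hi
  have hjX := of_isSubword_iff.2 hj
  rcases (by omega : 1 ≤ occ k a ∨ 1 ≤ occ k b ∨ 1 ≤ occ k c) with h | h | h <;>
    have hkX := of_isSubword_iff.2 h
  · left
    simpa using (((hkX.mul hiX).mul (.one b)).mul (.one X)).mul (.one c)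
  · left
    simpa using ((((IsSubword.one a).mul (.one X)).mul hkX).mul hiX).mul (.one c)
  · right
    simpa using ((((IsSubword.one a).mul hjX).mul (.one b)).mul hjX).mul hkX

theorem exists_eq_pow_of_lam_square {w X a b c : Word} {k : ℕ}
    (hw : ∀ i ∈ toList w, 2 ≤ occ i w → i = 0 ∨ i = 1) (hk : occ k w = 1) (h1 : 2 ≤ occ 1 w)
    (hadj : ¬ FirstTwoAdjacent 1 w) (hk1 : 1 ≠ k) (h11k : ¬ [1, 1, k].Sublist (squash w))
    (hk0 : ¬ (squash (of k * of 0)).Sublist (squash w)) (h : lam w (a * X * b * X * c)) :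
    ∃ m i, X = of m ^ i := by
  have hpres := preservesSimple_lam _ _ h
  have hX (i : ℕ) (hi : i ∈ toList X) : i = 0 ∨ i = 1 := by
    rw [mem_iff_occ] at hi
    have := hpres i
    simp only [occ_mul] at this
    exact hw i (mem_iff_occ.2 (by omega)) (by omega)
  have hnot : ¬ (0 ∈ toList X ∧ 1 ∈ toList X) := by
    rintro ⟨h0X, h1X⟩
    have := hpres k
    exact (isSubword_or_of_square (mem_iff_occ.1 h0X) (mem_iff_occ.1 h1X) (by omega)).elim
      (not_isSubword_of_squash h.1.2 hk0) (not_isSubword_of_lam h h1 hadj hk1 h11k)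
  by_cases h0X : 0 ∈ toList X
  · exact ⟨0, exists_eq_of_pow fun i hi => (hX i hi).resolve_right (by grind)⟩
  · exact ⟨1, exists_eq_of_pow fun i hi => (hX i hi).resolve_left (by grind)⟩

theorem FIC_varMα_lam {w c d : Word} {k : ℕ}
    (hw : ∀ i ∈ toList w, 2 ≤ occ i w → i = 0 ∨ i = 1) (hk : occ k w = 1) (h1 : 2 ≤ occ 1 w)
    (hadj : ¬ FirstTwoAdjacent 1 w) (hk1 : 1 ≠ k) (h11k : ¬ [1, 1, k].Sublist (squash w))
    (hk0 : ¬ (squash (of k * of 0)).Sublist (squash w)) (hc : 1 ≤ occ 0 c) :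
    FIC (varMα lam w) (c * x * d) (c * x ^ 2 * d) := by
  refine FIC_varMα_of_divides fun φ h => ?_
  obtain ⟨m, i, hi⟩ : ∃ m i, φ 0 = of m ^ i := by
    obtain ⟨c₁, c₂, rfl, -⟩ := exists_eq_mul_of_mul hc
    rcases h with ⟨a, b, h⟩ | ⟨a, b, h⟩
    · refine exists_eq_pow_of_lam_square (a := a * lift φ c₁) (b := lift φ c₂)
        (c := lift φ d * b) hw hk h1 hadj hk1 h11k hk0 ?_
      simpa [x, mul_assoc] using h
    · refine exists_eq_pow_of_lam_square (a := a * lift φ c₁) (b := lift φ c₂)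
        (c := φ 0 * lift φ d * b) hw hk h1 hadj hk1 h11k hk0 ?_
      simpa [x, mul_assoc, pow_two] using h
  exact lam_lift_sq hc d hi

/-! ### Joins of `𝐌_λ(xyx⁺)` with varieties `𝐌_γ'(w)` -/

theorem gam'_iff {u v : Word} : gam' u v ↔ gam u v ∧ FIC (varM (x * y * x)) u v := Iff.rfl

theorem nonmodular_lam_gam' {w u v e₁ e₂ : Word} (k j : ℕ) (l : List ℕ) (f g : Word)
    (hj : lift (restrict [1, j]) w = x * y * x)
    (hw : ∀ a ∈ toList w, 2 ≤ occ a w → a = 0 ∨ a = 1)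
    (huv : SwapEquiv u v) (he : SwapEquiv e₁ e₂)
    (hu : CollapseEquiv u e₁) (hv : CollapseEquiv v e₂)
    (hclass : gam' w (lift (erase l) u)) (hne : squash w ≠ squash (lift (erase l) v))
    (hk : occ k u = 1) (hk0 : k ≠ 0) (hmul : ∀ a ∈ toList u, 2 ≤ occ a u → a = 0 ∨ a = 1)
    (hlam : lam (x * y * x) (lift (restrict [0, k]) u))
    (hf : ∀ p, FIC (varMα lam (x * y * x)) u p → FIC (varMα gam' w) u p → ¬ IsSubword f p)
    (hg : ¬ IsSubword (lift (restrict [1, j]) (lift (erase l) g)) (x * y * x))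
    (h₁ : Blocked [x * x * of k, f, g] k e₁) (h₂ : Blocked [x * x * of k, f, g] k e₂) :
    HasNonmodularSubvarietyLattice (varMα lam (x * y * x) ⊔ varMα gam' w) := by
  refine nonmodular_of_swap k [x * x * of k, f, g] preservesSimple_lam (m := 1) (by decide)
    (by decide) huv he (FIC_varMα_gam' j hj hw hu) (FIC_varMα_gam' j hj hw hv)
    (not_FIC_varMα (erase l) hclass fun h => hne h.1.2) (fun p hpA hpB => ?_) hk hmul h₁ h₂
  simp only [List.forall_mem_cons, List.not_mem_nil, false_imp_iff, implies_true, and_true]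
  exact ⟨not_isSubword_of_varMα_lam k hk0 hpA hlam, hf p hpA hpB,
    not_isSubword_of_varMα gam'_le_FIC_xyx hpB (erase l) hclass [1, j] hj hg⟩

theorem nonmodular_lam_gam'_yx2ty : HasNonmodularSubvarietyLattice
    (varMα lam (x * y * x) ⊔ varMα gam' (y * x ^ 2 * t * y)) := by
  have hclass : gam' (y * x ^ 2 * t * y) (lift (erase [4]) (y * x * s * x ^ 2 * t * y)) :=
    gam'_iff.2 ⟨by decide, FIC_xyx_cube y (t * y)⟩
  exact nonmodular_lam_gam' (u := y * x * s * x ^ 2 * t * y) (v := x * y * s * x ^ 2 * t * y)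
    (e₁ := y * x ^ 2 * s * x * t * y) (e₂ := x ^ 2 * y * s * x * t * y) 4 3 [4]
    (s * y * y) (y * y * y) rfl (by decide) (by decide) (by decide) (by decide) (by decide)
    hclass (by decide) (by decide) (by decide) (by decide) (by decide)
    (fun _ _ h => not_isSubword_of_varMα (w := y * x ^ 2 * t * y) gam'_le_FIC_xyx h
      (fun i => if i = 1 then y else if i = 4 then x ^ 2 * t else 1) (by exact gam'.refl _) [1, 3]
      rfl (by decide))
    (by decide) (by decide) (by decide)

theorem isSubword_of_head?_squash {a b : ℕ} {p : Word} (hab : a ≠ b) (hb : 1 ≤ occ b p)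
    (h : (squash (lift (restrict [a, b]) p)).head? = some 0) : IsSubword (of a * of b) p := by
  obtain ⟨c, d, rfl, hc⟩ := exists_eq_mul_of_mul hb
  have ha : a ∈ toList c := by
    by_contra ha
    have hone : lift (restrict [a, b]) c = 1 := by
      refine eq_one_of_forall_notMem fun m hm => ?_
      obtain ⟨i, hi, hm⟩ := by simpa only [toList_lift, List.mem_flatMap] using hm
      have hia : i ≠ a := fun hia => ha (hia ▸ hi)
      have hib : i ≠ b := fun hib => List.count_eq_zero.1 hc (hib ▸ hi)
      simp [restrict, hia, hib] at hm
    have hlift : lift (restrict [a, b]) (c * of b * d) = of 1 * lift (restrict [a, b]) d := by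
      simp [hone, restrict, List.idxOf_cons_ne, hab]
    rw [hlift, head?_squash] at h
    cases h
  have := ((of_isSubword_iff.2 (mem_iff_occ.1 ha)).mul (IsSubword.refl (of b))).mul (.one d)
  simpa using this

theorem nonmodular_lam_gam'_ytyx2 : HasNonmodularSubvarietyLattice
    (varMα lam (x * y * x) ⊔ varMα gam' (y * t * y * x ^ 2)) := by
  have hclass : gam' (y * t * y * x ^ 2) (lift (erase [4]) (y * t * y * x * s * x ^ 2)) :=
    gam'_iff.2 ⟨by decide, FIC_xyx_cube (y * t * y) 1⟩
  refine nonmodular_lam_gam' (u := y * t * y * x * s * x ^ 2) (v := y * t * x * y * s * x ^ 2)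
    (e₁ := y * t * y * x ^ 2 * s * x) (e₂ := y * t * x ^ 2 * y * s * x) 4 3 [4] (s * y)
    (y * y * y) rfl (by decide) (by decide) (by decide) (by decide) (by decide) hclass
    (by decide) (by decide) (by decide) (by decide) (by decide) (fun p hA hB hsy => ?_)
    (by decide) (by decide) (by decide)
  have hp : lam (x * y * x) (lift (restrict [0, 4]) p) := by
    simpa using class_of_FIC_varMα hA (restrict [0, 4]) 1 1 (by decide)
  have hs : occ 4 p = 1 := by
    have := (preservesSimple_lam.FIC_varMα (w := x * y * x) (k := 1) (by decide)) _ _ hA 4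
    have hu : occ 4 (y * t * y * x * s * x ^ 2) = 1 := by decide
    omega
  have hxs : IsSubword (x * s) p :=
    isSubword_of_head?_squash (by decide) hs.ge (by rw [← hp.1.2]; decide)
  have hxy : ¬ IsSubword (x * y) p :=
    not_isSubword_of_class hB (erase [4]) hclass fun q hq =>
      not_isSubword_of_squash hq.1.2 (by decide)
  exact hxy (IsSubword.trans (by decide) (IsSubword.glue hs hxs hsy))

theorem nonmodular_lam_gam'_x2yzytx2 : HasNonmodularSubvarietyLattice
    (varMα lam (x * y * x) ⊔ varMα gam' (x ^ 2 * y * z * y * t * x ^ 2)) := by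
  have hclass : gam' (x ^ 2 * y * z * y * t * x ^ 2)
      (lift (erase []) (x * y * z * y * t * x ^ 2)) :=
    gam'_iff.2 ⟨by decide, CollapseEquiv.FIC_xyx (by decide)⟩
  exact nonmodular_lam_gam' (u := x * y * z * y * t * x ^ 2) (v := y * x * z * y * t * x ^ 2)
    (e₁ := x ^ 2 * y * z * y * t * x) (e₂ := y * x ^ 2 * z * y * t * x) 2 2 [] (z * y * y)
    (y * y * y) rfl (by decide) (by decide) (by decide) (by decide) (by decide) hclass
    (by decide) (by decide) (by decide) (by decide) (by decide)
    (fun _ _ h => not_isSubword_of_varMα gam'_le_FIC_xyx h (erase []) hclass [1, 2]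
      rfl (by decide))
    (by decide) (by decide) (by decide)

theorem nonmodular_lam_gam'_x2yzx2ty : HasNonmodularSubvarietyLattice
    (varMα lam (x * y * x) ⊔ varMα gam' (x ^ 2 * y * z * x ^ 2 * t * y)) := by
  have hclass : gam' (x ^ 2 * y * z * x ^ 2 * t * y)
      (lift (erase []) (x * y * z * x ^ 2 * t * y)) :=
    gam'_iff.2 ⟨by decide, CollapseEquiv.FIC_xyx (by decide)⟩
  exact nonmodular_lam_gam' (u := x * y * z * x ^ 2 * t * y) (v := y * x * z * x ^ 2 * t * y)
    (e₁ := x ^ 2 * y * z * x * t * y) (e₂ := y * x ^ 2 * z * x * t * y) 2 2 [] (z * y * y)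
    (y * y * y) rfl (by decide) (by decide) (by decide) (by decide) (by decide) hclass
    (by decide) (by decide) (by decide) (by decide) (by decide)
    (fun _ _ h => not_isSubword_of_varMα gam'_le_FIC_xyx h (erase []) hclass [1, 2]
      rfl (by decide))
    (by decide) (by decide) (by decide)

theorem nonmodular_lam_gam'_yzx2ytx2 : HasNonmodularSubvarietyLattice
    (varMα lam (x * y * x) ⊔ varMα gam' (y * z * x ^ 2 * y * t * x ^ 2)) := by
  have hclass : gam' (y * z * x ^ 2 * y * t * x ^ 2)
      (lift (erase []) (y * z * x * y * t * x ^ 2)) :=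
    gam'_iff.2 ⟨by decide, CollapseEquiv.FIC_xyx (by decide)⟩
  exact nonmodular_lam_gam' (u := y * z * x * y * t * x ^ 2) (v := y * z * y * x * t * x ^ 2)
    (e₁ := y * z * x ^ 2 * y * t * x) (e₂ := y * z * y * x ^ 2 * t * x) 3 2 [] (t * y)
    (y * y * y) rfl (by decide) (by decide) (by decide) (by decide) (by decide) hclass
    (by decide) (by decide) (by decide) (by decide) (by decide)
    (fun _ _ h => not_isSubword_of_class h (erase []) hclass fun q hq =>
      not_isSubword_of_squash hq.1.2 (by decide))
    (by decide) (by decide) (by decide)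

theorem nonmodular_lam_gam'_x2zytx2y : HasNonmodularSubvarietyLattice
    (varMα lam (x * y * x) ⊔ varMα gam' (x ^ 2 * z * y * t * x ^ 2 * y)) := by
  have hclass : gam' (x ^ 2 * z * y * t * x ^ 2 * y)
      (lift (erase []) (x * z * y * t * x ^ 2 * y)) :=
    gam'_iff.2 ⟨by decide, CollapseEquiv.FIC_xyx (by decide)⟩
  exact nonmodular_lam_gam' (u := x * z * y * t * x ^ 2 * y) (v := x * z * y * t * y * x ^ 2)
    (e₁ := x ^ 2 * z * y * t * x * y) (e₂ := x ^ 2 * z * y * t * y * x) 3 3 [] (t * y * y)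
    (y * y * y) rfl (by decide) (by decide) (by decide) (by decide) (by decide) hclass
    (by decide) (by decide) (by decide) (by decide) (by decide)
    (fun _ _ h => not_isSubword_of_varMα gam'_le_FIC_xyx h (erase []) hclass [1, 3]
      rfl (by decide))
    (by decide) (by decide) (by decide)

/-! ### The join of `𝐌_λ(xyx⁺)` and its dual -/

theorem lift_reverse (φ : ℕ → Word) (u : Word) :
    (lift φ u).reverse = lift (fun i => (φ i).reverse) u.reverse := by
  induction u using FreeMonoid.inductionOn' with
  | one => rfl
  | of_mul a u ih => simp [FreeMonoid.reverse_mul, ih]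

theorem divides_dualCon {α : Con Word} {w p : Word} :
    Divides (dualCon α) w p ↔ Divides α w.reverse p.reverse := by
  constructor
  · rintro ⟨a, b, h⟩
    exact ⟨b.reverse, a.reverse, by
      rwa [mul_assoc, ← FreeMonoid.reverse_mul, ← FreeMonoid.reverse_mul]⟩
  · rintro ⟨a, b, h⟩
    refine ⟨b.reverse, a.reverse, ?_⟩
    change α w.reverse (b.reverse * p * a.reverse).reverse
    rwa [FreeMonoid.reverse_mul, FreeMonoid.reverse_mul, FreeMonoid.reverse_reverse,
      FreeMonoid.reverse_reverse, ← mul_assoc]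

theorem FIC_varMα_dualCon {α : Con Word} {w u v : Word} :
    FIC (varMα (dualCon α) w) u v ↔ FIC (varMα α w.reverse) u.reverse v.reverse := by
  simp only [FIC_varMα, divides_dualCon, lift_reverse]
  constructor
  · intro h φ
    simpa [dualCon, lift_reverse] using h fun i => (φ i).reverse
  · intro h φ
    simpa [dualCon, lift_reverse] using h fun i => (φ i).reverse

theorem eq_zero_of_two_le_occ_xyx {a : ℕ} (h : 2 ≤ occ a (x * y * x)) : a = 0 := by
  simp only [x, y, occ_mul, occ_of] at h
  by_contra
  split_ifs at h <;> omega

theorem FIC_varMα_lam_xyx {c : Word} (hc : 1 ≤ occ 0 c) (d : Word) :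
    FIC (varMα lam (x * y * x)) (c * x * d) (c * x ^ 2 * d) := by
  refine FIC_varMα_of_divides fun φ h => ?_
  have hφ : ∀ a ∈ toList (φ 0), a = 0 := fun a ha => by
    refine eq_zero_of_two_le_occ_xyx (h.elim (fun h => ?_) fun h => ?_) <;>
    · refine preservesSimple_lam.two_le_occ h (c := 0) ?_ ha
      simp only [x, occ_mul, occ_pow, occ_of, if_true]
      omega
  obtain ⟨i, hi⟩ := exists_eq_of_pow hφ
  exact lam_lift_sq hc d hi

theorem FIC_varMα_dualCon_lam_xyx (c : Word) {d : Word} (hd : 1 ≤ occ 0 d) :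
    FIC (varMα (dualCon lam) (x * y * x)) (c * x * d) (c * x ^ 2 * d) := by
  refine FIC_varMα_dualCon.2 ?_
  simpa [x, y, FreeMonoid.reverse_mul, pow_two, mul_assoc] using
    FIC_varMα_lam_xyx (c := d.reverse) (by rwa [occ_reverse]) c.reverse

theorem occ_le_two_of_not_isSubword {p : Word} (hy : 1 ≤ occ 1 p) (h₁ : ¬ IsSubword (x * x * y) p)
    (h₂ : ¬ IsSubword (y * x * x) p) : occ 0 p ≤ 2 := by
  have hsq : ∀ c : Word, ¬ IsSubword (x * x) c → occ 0 c ≤ 1 := fun c hc =>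
    Nat.le_of_lt_succ (not_le.1 fun h => hc (List.replicate_sublist_iff.2 h))
  obtain ⟨c, d, rfl, -⟩ := exists_eq_mul_of_mul hy
  have hc := hsq c fun h => h₁ (by simpa [y] using (h.mul (.refl y)).mul (.one d))
  have hd := hsq d fun h => h₂ (by
    simpa [mul_assoc, y] using (IsSubword.one c).mul (.mul (.refl y) h))
  simp only [occ_mul, occ_of, one_ne_zero, if_false]
  omega

theorem occ_le_two_of_FIC_lam_dual {p : Word} (hA : FIC (varMα lam (x * y * x)) (x * y * x) p)
    (hB : FIC (varMα (dualCon lam) (x * y * x)) (x * y * x) p) (a : ℕ) : occ a p ≤ 2 := by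
  have hsimple := preservesSimple_lam.FIC_varMα (w := x * y * x) (k := 1) (by decide) _ _ hA
  by_contra ha
  have ha₀ : a = 0 := eq_zero_of_two_le_occ_xyx (by have := hsimple a; omega)
  subst ha₀
  have hB' : FIC (varMα lam (x * y * x)) (x * y * x) p.reverse := by
    simpa [x, y, FreeMonoid.reverse_mul, mul_assoc] using FIC_varMα_dualCon.1 hB
  have hy : occ 1 (x * y * x) = 1 := by decide
  refine ha (occ_le_two_of_not_isSubword (by have := hsimple 1; omega) ?_ fun h => ?_)
  · exact not_isSubword_of_varMα_lam 1 (by decide) hA (by exact lam.refl _)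
  · exact not_isSubword_of_varMα_lam 1 (by decide) hB' (by exact lam.refl _)
      (List.reverse_sublist.2 h)

theorem nonmodular_lam_dual : HasNonmodularSubvarietyLattice
    (varMα lam (x * y * x) ⊔ varMα (dualCon lam) (x * y * x)) := by
  refine nonmodular_of_trivial_instances (e₁ := x ^ 2 * y * x) (e₂ := x ^ 2 * y * x ^ 2)
    (u := x * y * x) (v := x * y * x ^ 2)
    (by simpa using FIC_varMα_lam_xyx (c := x ^ 2 * y) (by decide) 1)
    (by simpa using FIC_varMα_lam_xyx (c := x * y) (by decide) 1)
    (inf_var_le_var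
      (by simpa [mul_assoc] using FIC_varMα_dualCon_lam_xyx 1 (d := y * x) (by decide))
      (by simpa [mul_assoc] using FIC_varMα_dualCon_lam_xyx 1 (d := y * x ^ 2) (by decide)))
    (fun h => ?_) fun φ a b h => ?_
  · have hne : ¬ dualCon lam (x * y * x) (lift of (x * y * x ^ 2)) := by
      rw [lift_of]
      change ¬ lam (x * y * x) (x ^ 2 * y * x)
      decide
    exact not_FIC_varMα of (by exact (dualCon lam).refl _) hne (FIC_sup.1 h).2
  have hφ : φ 0 = 1 := eq_one_of_forall_notMem fun g hg => by
    rw [mem_iff_occ] at hg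
    have he₁ := mul_occ_le_occ_lift φ g 0 (x ^ 2 * y * x)
    have he₂ := mul_occ_le_occ_lift φ g 0 (x ^ 2 * y * x ^ 2)
    rw [show occ 0 (x ^ 2 * y * x) = 3 by decide] at he₁
    rw [show occ 0 (x ^ 2 * y * x ^ 2) = 4 by decide] at he₂
    rcases h with h | h <;>
    · have hle := occ_le_two_of_FIC_lam_dual (FIC_sup.1 h).1 (FIC_sup.1 h).2 g
      simp only [occ_mul] at hle
      omega
  simp [x, y, hφ]

/-! ### Joins with `𝐌(xyx)` -/

theorem nonmodular_xyx {B : Variety} {u v e₁ e₂ : Word} (i j : ℕ)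
    (hi : lift (restrict [0, i]) u = x * y * x) (hj : lift (restrict [1, j]) u = x * y * x)
    (hx : ¬ IsSubword (lift (restrict [0, i]) (x * x * x)) (x * y * x))
    (hy : ¬ IsSubword (lift (restrict [1, j]) (y * y * y)) (x * y * x))
    (huv : SwapEquiv u v) (he : SwapEquiv e₁ e₂) (hu : FIC B u e₁) (hv : FIC B v e₂)
    (hV : ¬ FIC B u v) (hk : occ 3 u = 1)
    (hmul : ∀ a ∈ toList u, 2 ≤ occ a u → a = 0 ∨ a = 1)
    (h₁ : Blocked [x * x * x, y * y * y] 3 e₁) (h₂ : Blocked [x * x * x, y * y * y] 3 e₂) :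
    HasNonmodularSubvarietyLattice (varM (x * y * x) ⊔ B) := by
  rw [varM_eq_varMα_bot]
  refine nonmodular_of_swap 3 [x * x * x, y * y * y] preservesSimple_bot (m := 1) (by decide)
    (by decide) huv he hu hv hV (fun p hp _ => ?_) hk hmul h₁ h₂
  rw [← varM_eq_varMα_bot] at hp
  simp only [List.forall_mem_cons, List.not_mem_nil, false_imp_iff, implies_true, and_true]
  exact ⟨not_isSubword_of_FIC_restrict hp [0, i] hi hx,
    not_isSubword_of_FIC_restrict hp [1, j] hj hy⟩

theorem nonmodular_xyx_lam_xyzxty : HasNonmodularSubvarietyLattice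
    (varM (x * y * x) ⊔ varMα lam (x * y * z * x * t * y)) :=
  nonmodular_xyx (u := x * y * z * x * t * y) (v := y * x * z * x * t * y)
    (e₁ := x * y * z * x ^ 2 * t * y) (e₂ := y * x * z * x ^ 2 * t * y) 2 3 rfl rfl
    (by decide) (by decide) (by decide) (by decide)
    (FIC_varMα_lam (c := x * y * z) (d := t * y) (k := 3) (by decide) (by decide) (by decide)
      (by decide) (by decide) (by decide) (by decide) (by decide))
    (FIC_varMα_lam (c := y * x * z) (d := t * y) (k := 3) (by decide) (by decide) (by decide)
      (by decide) (by decide) (by decide) (by decide) (by decide))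
    (not_FIC_varMα (erase []) (by exact lam.refl _) (by decide))
    (by decide) (by decide) (by decide) (by decide)

theorem nonmodular_xyx_lam_x2yty : HasNonmodularSubvarietyLattice
    (varM (x * y * x) ⊔ varMα lam (x ^ 2 * y * t * y)) :=
  nonmodular_xyx (u := x * s * x * y * t * y) (v := x * s * y * x * t * y)
    (e₁ := x * s * x ^ 2 * y * t * y) (e₂ := x * s * y * x ^ 2 * t * y) 4 3 rfl rfl
    (by decide) (by decide) (by decide) (by decide)
    (FIC_varMα_lam (c := x * s) (d := y * t * y) (k := 3) (by decide) (by decide) (by decide)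
      (by decide) (by decide) (by decide) (by decide) (by decide))
    (FIC_varMα_lam (c := x * s * y) (d := t * y) (k := 3) (by decide) (by decide) (by decide)
      (by decide) (by decide) (by decide) (by decide) (by decide))
    (not_FIC_varMα (erase [4]) (by exact lam.refl _) (by decide))
    (by decide) (by decide) (by decide) (by decide)

/-! ### Joins with `𝐌(xyxzx)` -/

theorem nonmodular_xyxzx {B : Variety} {u v e₁ e₂ : Word} (i j l : ℕ)
    (hi : lift (restrict [0, i, j]) u = x * y * x * z * x)
    (hl : lift (restrict [1, l]) u = x * y * x)
    (hx : ¬ IsSubword (lift (restrict [0, i, j]) (x * x * x * x)) (x * y * x * z * x))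
    (hy : ¬ IsSubword (lift (restrict [1, l]) (y * y * y * y)) (x * y * x * z * x))
    (huv : SwapEquiv u v) (he : SwapEquiv e₁ e₂) (hu : FIC B u e₁) (hv : FIC B v e₂)
    (hV : ¬ FIC B u v) (hk : occ 3 u = 1)
    (hmul : ∀ a ∈ toList u, 2 ≤ occ a u → a = 0 ∨ a = 1)
    (h₁ : Blocked [x * x * x * x, y * y * y * y] 3 e₁)
    (h₂ : Blocked [x * x * x * x, y * y * y * y] 3 e₂) :
    HasNonmodularSubvarietyLattice (varM (x * y * x * z * x) ⊔ B) := by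
  rw [varM_eq_varMα_bot]
  refine nonmodular_of_swap 3 [x * x * x * x, y * y * y * y] preservesSimple_bot (m := 1)
    (by decide) (by decide) huv he hu hv hV (fun p hp _ => ?_) hk hmul h₁ h₂
  rw [← varM_eq_varMα_bot] at hp
  simp only [List.forall_mem_cons, List.not_mem_nil, false_imp_iff, implies_true, and_true]
  exact ⟨not_isSubword_of_FIC_varM (a := 1) (b := 1) hp (by simp [hi]) hx,
    not_isSubword_of_FIC_varM (a := 1) (b := z * x) hp (by simp [hl, mul_assoc]) hy⟩

theorem nonmodular_xyxzx_gam'_yx2ty : HasNonmodularSubvarietyLattice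
    (varM (x * y * x * z * x) ⊔ varMα gam' (y * x ^ 2 * t * y)) := by
  have hclass : gam' (y * x ^ 2 * t * y)
      (lift (erase [2, 4]) (y * x * s * x * z * x * t * y)) :=
    gam'_iff.2 ⟨by decide, FIC_xyx_cube y (t * y)⟩
  exact nonmodular_xyxzx (u := y * x * s * x * z * x * t * y) (v := x * y * s * x * z * x * t * y)
    (e₁ := y * x * s * x * z * x ^ 2 * t * y) (e₂ := x * y * s * x * z * x ^ 2 * t * y)
    4 2 3 rfl rfl (by decide) (by decide) (by decide) (by decide)
    (FIC_varMα_gam' 3 rfl (by decide) (by decide)) (FIC_varMα_gam' 3 rfl (by decide) (by decide))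
    (not_FIC_varMα (erase [2, 4]) hclass fun h => absurd h.1.2 (by decide)) (by decide)
    (by decide) (by decide) (by decide)

theorem nonmodular_xyxzx_gam'_x2yty : HasNonmodularSubvarietyLattice
    (varM (x * y * x * z * x) ⊔ varMα gam' (x ^ 2 * y * t * y)) := by
  have hclass : gam' (x ^ 2 * y * t * y)
      (lift (erase [2, 4]) (x * s * x * z * x * y * t * y)) :=
    gam'_iff.2 ⟨by decide, FIC_xyx_cube 1 (y * t * y)⟩
  exact nonmodular_xyxzx (u := x * s * x * z * x * y * t * y) (v := x * s * x * z * y * x * t * y)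
    (e₁ := x * s * x * z * x ^ 2 * y * t * y) (e₂ := x * s * x * z * y * x ^ 2 * t * y)
    4 2 3 rfl rfl (by decide) (by decide) (by decide) (by decide)
    (FIC_varMα_gam' 3 rfl (by decide) (by decide)) (FIC_varMα_gam' 3 rfl (by decide) (by decide))
    (not_FIC_varMα (erase [2, 4]) hclass fun h => absurd h.1.2 (by decide)) (by decide)
    (by decide) (by decide) (by decide)

theorem nonmodular_xyxzx_lam' {w c c' d d' : Word} (l : ℕ)
    (hw₀ : lift (restrict [1, 2]) w = x * y * x)
    (hw : ∀ a ∈ toList w, 2 ≤ occ a w → a = 0 ∨ a = 1)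
    (hc : 1 ≤ occ 0 c) (hcd : CollapseEquiv (c * x * d) (c * x ^ 2 * d))
    (hc' : 1 ≤ occ 0 c') (hcd' : CollapseEquiv (c' * x * d') (c' * x ^ 2 * d'))
    (hl : lift (restrict [0, l, 4]) (c * x * d) = x * y * x * z * x)
    (hy₀ : lift (restrict [1, 2]) (c * x * d) = x * y * x)
    (hx : ¬ IsSubword (lift (restrict [0, l, 4]) (x * x * x * x)) (x * y * x * z * x))
    (huv : SwapEquiv (c * x * d) (c' * x * d'))
    (he : SwapEquiv (c * x ^ 2 * d) (c' * x ^ 2 * d'))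
    (hclass : lift (erase [4]) (c * x * d) = w)
    (hne : squash w ≠ squash (lift (erase [4]) (c' * x * d')))
    (hk : occ 3 (c * x * d) = 1)
    (hmul : ∀ a ∈ toList (c * x * d), 2 ≤ occ a (c * x * d) → a = 0 ∨ a = 1)
    (h₁ : Blocked [x * x * x * x, y * y * y * y] 3 (c * x ^ 2 * d))
    (h₂ : Blocked [x * x * x * x, y * y * y * y] 3 (c' * x ^ 2 * d')) :
    HasNonmodularSubvarietyLattice (varM (x * y * x * z * x) ⊔ varMα lam' w) :=
  nonmodular_xyxzx l 4 2 hl hy₀ hx (by decide) huv he (FIC_varMα_lam' 2 hw₀ hw hc hcd)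
    (FIC_varMα_lam' 2 hw₀ hw hc' hcd')
    (not_FIC_varMα (erase [4]) (hclass ▸ lam'.refl _) fun h => hne h.1.1.2) hk hmul h₁ h₂

theorem nonmodular_xyxzx_lam'_xyzx2ty : HasNonmodularSubvarietyLattice
    (varM (x * y * x * z * x) ⊔ varMα lam' (x * y * z * x ^ 2 * t * y)) :=
  nonmodular_xyxzx_lam' (c := x * y * z * x * s) (c' := y * x * z * x * s) (d := t * y)
    (d' := t * y) 2 rfl (by decide) (by decide) (by decide) (by decide) (by decide) rfl rfl
    (by decide) (by decide) (by decide) rfl (by decide) (by decide) (by decide) (by decide)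
    (by decide)

theorem nonmodular_xyxzx_lam'_xyzytx2 : HasNonmodularSubvarietyLattice
    (varM (x * y * x * z * x) ⊔ varMα lam' (x * y * z * y * t * x ^ 2)) :=
  nonmodular_xyxzx_lam' (c := x * y * z * y * t * x * s) (c' := y * x * z * y * t * x * s)
    (d := 1) (d' := 1) 2 rfl (by decide) (by decide) (by decide) (by decide) (by decide) rfl rfl
    (by decide) (by decide) (by decide) rfl (by decide) (by decide) (by decide) (by decide)
    (by decide)

theorem nonmodular_xyxzx_lam'_yzyxtx2 : HasNonmodularSubvarietyLattice
    (varM (x * y * x * z * x) ⊔ varMα lam' (y * z * y * x * t * x ^ 2)) :=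
  nonmodular_xyxzx_lam' (c := y * z * y * x * t * x * s) (c' := y * z * x * y * t * x * s)
    (d := 1) (d' := 1) 3 rfl (by decide) (by decide) (by decide) (by decide) (by decide) rfl rfl
    (by decide) (by decide) (by decide) rfl (by decide) (by decide) (by decide) (by decide)
    (by decide)

/-! ### Words with a prescribed prefix -/

theorem mem_var_of_syntacticCon {S : Set Word} {I : Set (Word × Word)}
    (h : ∀ e ∈ I, syntacticCon S e.1 e.2) : MonCat.of (syntacticCon S).Quotient ∈ (var I).carrier :=
  fun e he => satisfies_syntacticCon.2 (h e he)

theorem FIC_context {V : Variety} {l r u v : Word} (h : FIC V l r) (φ : ℕ → Word) (a b : Word)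
    (hu : u = a * lift φ l * b) (hv : v = a * lift φ r * b) : FIC V u v := by
  subst hu hv
  exact (FIC V).mul ((FIC V).mul ((FIC V).refl a) (FIC_lift h φ)) ((FIC V).refl b)

/-- The words `p` with a single occurrence of `k` such that the part of `p` in front of `k`,
restricted to the letters of `L`, is `L`, and the number of occurrences of each letter of `L` in `p`
satisfies the condition `C`. -/
def prefixSet (L : List ℕ) (k : ℕ) (C : ℕ → ℕ → Prop) : Set Word :=
  {p | occ k p = 1 ∧ L ++ [k] <+: (toList p).filter (· ∈ k :: L) ∧ ∀ g ∈ L, C g (occ g p)}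

namespace prefixSet

variable {L : List ℕ} {k g : ℕ} {C : ℕ → ℕ → Prop}

theorem count_filter (hg : g ∈ k :: L) (q : Word) :
    ((toList q).filter (· ∈ k :: L)).count g = occ g q :=
  List.count_filter (by simpa using hg)

theorem filter_prefix {q b : Word} (h : q * b ∈ prefixSet L k C) (hq : occ k q = 0) :
    (toList q).filter (· ∈ k :: L) <+: L := by
  have hkq : k ∉ (toList q).filter (· ∈ k :: L) := by
    rw [← List.count_eq_zero, count_filter List.mem_cons_self, hq]
  have hfilter := h.2.1
  rw [FreeMonoid.toList_mul, List.filter_append] at hfilter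
  rcases List.prefix_or_prefix_of_prefix (List.prefix_append _ _) hfilter with hle | hle
  · refine (List.prefix_concat_iff.1 hle).resolve_left fun heq => hkq ?_
    rw [heq]
    exact List.mem_append_right _ (List.mem_singleton_self k)
  · exact absurd (hle.subset (List.mem_append_right _ (List.mem_singleton_self k))) hkq

theorem prefix_filter (hk : k ∉ L) {q b : Word} (h : q * b ∈ prefixSet L k C)
    (hq : 1 ≤ occ k q) : L ++ [k] <+: (toList q).filter (· ∈ k :: L) := by
  have hkq : k ∈ (toList q).filter (· ∈ k :: L) := by
    rwa [← List.one_le_count_iff, count_filter List.mem_cons_self]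
  have hfilter := h.2.1
  rw [FreeMonoid.toList_mul, List.filter_append] at hfilter
  rcases List.prefix_or_prefix_of_prefix (List.prefix_append _ _) hfilter with hle | hle
  · rcases List.prefix_concat_iff.1 hle with heq | hle
    · exact heq ▸ List.prefix_rfl
    · exact absurd (hle.subset hkq) hk
  · exact hle

theorem occ_le {q b : Word} (h : q * b ∈ prefixSet L k C) (hq : occ k q = 0) (hg : g ∈ L) :
    occ g q ≤ L.count g := by
  rw [← count_filter (List.mem_cons_of_mem k hg)]
  exact (filter_prefix h hq).sublist.count_le g

theorem le_occ (hk : k ∉ L) {q b : Word} (h : q * b ∈ prefixSet L k C) (hq : 1 ≤ occ k q)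
    (hg : g ∈ L) : L.count g ≤ occ g q := by
  rw [← count_filter (List.mem_cons_of_mem k hg)]
  exact ((List.prefix_append L [k]).trans (prefix_filter hk h hq)).sublist.count_le g

theorem sublist_of_isSubword {p f : Word} (h : p ∈ prefixSet L k C)
    (hf : ∀ a ∈ toList f, a ∈ L) (hs : IsSubword (f * of k) p) : (toList f).Sublist L := by
  obtain ⟨a, b, rfl, ha, hb⟩ := exists_eq_mul_of_mul_of_simple h.1
  have hfa : (toList f).Sublist (toList a) := sublist_of_concat_sublist_append_cons
    (b := toList b) (List.count_eq_zero.1 hb) (by simpa [IsSubword] using hs)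
  have hfilter : (toList f).filter (· ∈ k :: L) = toList f :=
    List.filter_eq_self.2 fun c hc => by simp [hf c hc]
  rw [← hfilter]
  rw [mul_assoc] at h
  exact (hfa.filter _).trans (filter_prefix h ha).sublist

theorem mul_mem_of_mul_mem (hk : k ∉ L) {q b b' : Word} (h : q * b ∈ prefixSet L k C)
    (hq : 1 ≤ occ k q) (hk' : occ k (q * b') = 1) (hC : ∀ g ∈ L, C g (occ g (q * b'))) :
    q * b' ∈ prefixSet L k C := by
  refine ⟨hk', ?_, hC⟩
  rw [FreeMonoid.toList_mul, List.filter_append]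
  exact (prefix_filter hk h hq).trans (List.prefix_append _ _)

theorem mem_of_filter_eq {p p' : Word}
    (h : (toList p).filter (· ∈ k :: L) = (toList p').filter (· ∈ k :: L))
    (hp : p ∈ prefixSet L k C) : p' ∈ prefixSet L k C := by
  have hocc : ∀ g ∈ k :: L, occ g p' = occ g p := fun g hg => by
    rw [← count_filter hg, ← count_filter hg, h]
  refine ⟨(hocc k List.mem_cons_self).trans hp.1, h ▸ hp.2.1, fun g hg => ?_⟩
  rw [hocc g (List.mem_cons_of_mem k hg)]
  exact hp.2.2 g hg

end prefixSet

theorem filter_lift_erase {K l : List ℕ} {φ : ℕ → Word} (h : ∀ i ∈ l, ∀ g ∈ K, occ g (φ i) = 0)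
    (u : Word) : (toList (lift φ (lift (erase l) u))).filter (· ∈ K) =
      (toList (lift φ u)).filter (· ∈ K) := by
  induction u using FreeMonoid.inductionOn' with
  | one => rfl
  | of_mul b u ih =>
    simp only [map_mul, FreeMonoid.lift_eval_of, FreeMonoid.toList_mul, List.filter_append, ih]
    congr 1
    unfold erase
    split_ifs with hb
    · refine (List.filter_eq_nil_iff.2 fun a ha => ?_).symm
      simpa using fun haK => List.count_eq_zero.1 (h b hb a haK) ha
    · rw [FreeMonoid.lift_eval_of]

namespace prefixSet

variable {L : List ℕ} {k : ℕ}

/-- If erasing the letters of `l` makes `u ≈ v` trivial and `c` is a common prefix of `u` and `v`,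
then an application of `u ≈ v` can only leave `prefixSet L k C` by changing numbers of occurrences,
provided that `k` occurs before the end of the image of `c` or the images of the letters of `l`
contain no relevant letters. -/
theorem replace_mem {C : ℕ → ℕ → Prop} (hk : k ∉ L) {l : List ℕ} {c u v : Word} (hcu : c ∣ u)
    (hcv : c ∣ v) (hE : lift (erase l) u = lift (erase l) v) {φ : ℕ → Word} {a b : Word}
    (hp : a * lift φ u * b ∈ prefixSet L k C)
    (h₁ : 1 ≤ occ k (a * lift φ c) →
      occ k (a * lift φ v * b) = 1 ∧ ∀ g ∈ L, C g (occ g (a * lift φ v * b)))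
    (h₂ : occ k (a * lift φ c) = 0 → ∀ i ∈ l, ∀ g ∈ k :: L, occ g (φ i) = 0) :
    a * lift φ v * b ∈ prefixSet L k C := by
  by_cases hc : 1 ≤ occ k (a * lift φ c)
  · obtain ⟨u', rfl⟩ := hcu
    obtain ⟨v', rfl⟩ := hcv
    have hassoc : ∀ d, a * lift φ (c * d) * b = (a * lift φ c) * (lift φ d * b) := fun d => by
      simp only [map_mul, mul_assoc]
    rw [hassoc] at hp h₁ ⊢
    exact mul_mem_of_mul_mem hk hp hc (h₁ hc).1 (h₁ hc).2
  · refine mem_of_filter_eq ?_ hp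
    simp only [FreeMonoid.toList_mul, List.filter_append]
    have hi := h₂ (by omega)
    rw [← filter_lift_erase hi u, hE, filter_lift_erase hi]

theorem occ_bounds {C : ℕ → ℕ → Prop} (hk : k ∉ L) {g : ℕ} (hg : g ∈ L) {d u : Word} (hd : d ∣ u)
    {φ : ℕ → Word} {a b : Word} (hp : a * lift φ u * b ∈ prefixSet L k C) :
    (occ k (a * lift φ d) = 0 → occ g (a * lift φ d) ≤ L.count g) ∧
      (1 ≤ occ k (a * lift φ d) → L.count g ≤ occ g (a * lift φ d)) := by
  obtain ⟨e, rfl⟩ := hd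
  have h : (a * lift φ d) * (lift φ e * b) ∈ prefixSet L k C := by
    simpa only [map_mul, mul_assoc] using hp
  exact ⟨fun hd => occ_le h hd hg, fun hd => le_occ hk h hd hg⟩

/-- The condition on occurrences under which applications of `u ≈ v` from left to right preserve
`prefixSet L k fun _ => C` for every list `L` without repetitions. Here `c` is a common prefix of
`u` and `v`, and `ds` is a list of prefixes of `u`. The images of these prefixes contain at most
(least) one occurrence of each letter of `L` if they avoid (contain) `k`. -/
def Preserves (C : ℕ → Prop) (c u v : Word) (ds : List Word) : Prop :=
  ∀ (φ : ℕ → Word) (a b : Word) (k g : ℕ),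
    occ k (a * lift φ u * b) = 1 → C (occ g (a * lift φ u * b)) →
    (∀ d ∈ c :: ds, (occ k (a * lift φ d) = 0 → occ g (a * lift φ d) ≤ 1) ∧
      (1 ≤ occ k (a * lift φ d) → 1 ≤ occ g (a * lift φ d))) →
    (1 ≤ occ k (a * lift φ c) → occ k (a * lift φ v * b) = 1 ∧ C (occ g (a * lift φ v * b))) ∧
      (occ k (a * lift φ c) = 0 → occ k (φ 0) = 0 ∧ occ g (φ 0) = 0)

theorem Preserves.mem {C : ℕ → Prop} {c u v : Word} {ds : List Word} (h : Preserves C c u v ds)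
    (hk : k ∉ L) (hL : L.Nodup) (hL' : L ≠ []) (hu : ∀ d ∈ c :: ds, d ∣ u) (hcv : c ∣ v)
    (hE : lift (erase [0]) u = lift (erase [0]) v) {φ : ℕ → Word} {a b : Word}
    (hp : a * lift φ u * b ∈ prefixSet L k fun _ => C) :
    a * lift φ v * b ∈ prefixSet L k fun _ => C := by
  have hstep := fun g hg => h φ a b k g hp.1 (hp.2.2 g hg) fun d hd => by
    simpa only [List.count_eq_one_of_mem hL hg] using occ_bounds hk hg (hu d hd) hp
  obtain ⟨g₀, hg₀⟩ := List.exists_mem_of_ne_nil L hL'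
  refine replace_mem hk (hu c List.mem_cons_self) hcv hE hp
    (fun hc => ⟨((hstep g₀ hg₀).1 hc).1, fun g hg => ((hstep g hg).1 hc).2⟩) ?_
  simp only [List.forall_mem_singleton, List.forall_mem_cons]
  exact fun hc => ⟨((hstep g₀ hg₀).2 hc).1, fun g hg => ((hstep g hg).2 hc).2⟩

theorem syntacticCon_of_preserves {C : ℕ → Prop} {u v : Word} (c : Word) (ds es : List Word)
    (hk : k ∉ L) (hL : L.Nodup) (hL' : L ≠ []) (hu : ∀ d ∈ c :: ds, d ∣ u)
    (hv : ∀ d ∈ c :: es, d ∣ v) (hE : lift (erase [0]) u = lift (erase [0]) v)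
    (h₁ : Preserves C c u v ds) (h₂ : Preserves C c v u es) :
    syntacticCon (prefixSet L k fun _ => C) u v :=
  fun _ _ _ => ⟨h₁.mem hk hL hL' hu (hv c List.mem_cons_self) hE,
    h₂.mem hk hL hL' hv (hu c List.mem_cons_self) hE.symm⟩

end prefixSet

theorem dvd_iff_prefix {d u : Word} : d ∣ u ↔ toList d <+: toList u :=
  ⟨fun ⟨e, he⟩ => ⟨toList e, by rw [he, FreeMonoid.toList_mul]⟩,
    fun ⟨e, he⟩ => ⟨FreeMonoid.ofList e, toList.injective (by simp [he])⟩⟩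

instance decidableDvd (d u : Word) : Decidable (d ∣ u) := decidable_of_iff' _ dvd_iff_prefix

open prefixSet

theorem mem_H {L : List ℕ} {k : ℕ} (hk : k ∉ L) (hL : L.Nodup) (hL' : L ≠ []) :
    MonCat.of (syntacticCon (prefixSet L k fun _ n => 2 ≤ n)).Quotient ∈ H.carrier := by
  refine mem_inf.2 ⟨mem_var_of_syntacticCon ?_, mem_var_of_syntacticCon ?_⟩ <;>
    simp only [Set.forall_mem_insert, Set.mem_singleton_iff, forall_eq]
  · refine ⟨syntacticCon_of_preserves 1 [x ^ 2] [x ^ 3] hk hL hL' ?_ ?_ rfl ?_ ?_,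
      syntacticCon_of_preserves 1 [x ^ 2] [y ^ 2 * x ^ 2] hk hL hL' ?_ ?_ rfl ?_ ?_,
      syntacticCon_of_preserves (x * y * x) [x * y * x] [x * y * x] hk hL hL' ?_ ?_ rfl ?_ ?_,
      syntacticCon_of_preserves (x ^ 2 * y) [x ^ 2] [x ^ 2] hk hL hL' ?_ ?_ rfl ?_ ?_⟩
    all_goals first
      | decide
      | intro φ a b k g
        simp only [x, y, map_mul, map_pow, map_one, FreeMonoid.lift_eval_of, occ_mul, occ_pow,
          occ_one, List.forall_mem_cons]
        omega
  · refine syntacticCon_of_preserves 1 [x * y * x] [y * x ^ 2] hk hL hL' ?_ ?_ rfl ?_ ?_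
    all_goals first
      | decide
      | intro φ a b k g
        simp only [x, y, t, map_mul, map_pow, map_one, FreeMonoid.lift_eval_of, occ_mul, occ_pow,
          occ_one, List.forall_mem_cons]
        omega

theorem mem_var_eta {L : List ℕ} {k : ℕ} (hk : k ∉ L) (hL : L.Nodup) (hL' : L ≠ []) :
    MonCat.of (syntacticCon (prefixSet L k fun _ n => 2 ≤ n)).Quotient ∈
      (var {(x * y * x * z, x * y * x * z * x),
        (y * t * x ^ 2 * y, y * t * y * x ^ 2)}).carrier := by
  refine mem_var_of_syntacticCon ?_
  simp only [Set.forall_mem_insert, Set.mem_singleton_iff, forall_eq]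
  refine ⟨syntacticCon_of_preserves (x * y * x * z) [x * y * x] [x * y * x] hk hL hL' ?_ ?_ rfl
      ?_ ?_,
    syntacticCon_of_preserves (y * t) [y * t * x ^ 2] [y * t * y * x ^ 2] hk hL hL' ?_ ?_ rfl
      ?_ ?_⟩
  all_goals first
    | decide
    | intro φ a b k g
      simp only [x, y, z, t, map_mul, map_pow, FreeMonoid.lift_eval_of, occ_mul, occ_pow,
        List.forall_mem_cons]
      omega

theorem mem_N {L : List ℕ} {k : ℕ} (hk : k ∉ L) (hL : L.Nodup) (hL' : L ≠ []) :
    MonCat.of (syntacticCon (prefixSet L k fun _ n => n = 2)).Quotient ∈ N.carrier := by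
  refine mem_var_of_syntacticCon ?_
  simp only [Set.forall_mem_insert, Set.mem_singleton_iff, forall_eq]
  refine ⟨syntacticCon_of_preserves 1 [x ^ 2] [x ^ 3] hk hL hL' ?_ ?_ rfl ?_ ?_,
    syntacticCon_of_preserves 1 [x ^ 2] [y * x ^ 2, y] hk hL hL' ?_ ?_ rfl ?_ ?_,
    syntacticCon_of_preserves 1 [x * y * x] [x ^ 2] hk hL hL' ?_ ?_ rfl ?_ ?_,
    syntacticCon_of_preserves (x * z * y * t) [x * z * y * t * x] [x * z * y * t * y * x]
      hk hL hL' ?_ ?_ rfl ?_ ?_,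
    syntacticCon_of_preserves (x * z) [x * z * x] [x * z * y * x] hk hL hL' ?_ ?_ rfl ?_ ?_⟩
  all_goals first
    | decide
    | intro φ a b k g
      simp only [x, y, z, t, map_mul, map_pow, map_one, FreeMonoid.lift_eval_of, occ_mul, occ_pow,
        occ_one, List.forall_mem_cons]
      omega

theorem preservesSimple_mu : PreservesSimple mu := by
  intro p q hpq a
  have hS : MonCat.of (syntacticCon {p | min (occ a p) 2 = min (occ a q) 2}).Quotient ∈
      (var {(x ^ 2, x ^ 3), (x * y * x * z * x, x * y * x * z * x ^ 2)}).carrier := by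
    refine mem_var_of_syntacticCon ?_
    simp only [Set.forall_mem_insert, Set.mem_singleton_iff, forall_eq]
    constructor <;> intro φ b c <;>
      simp only [x, y, z, map_mul, map_pow, FreeMonoid.lift_eval_of, occ_mul, occ_pow,
        Set.mem_ofPred_eq] <;> omega
  exact (mem_iff_of_FIC hS hpq).2 rfl

/-- The class of `xyxzx` with respect to `μ`. -/
def muClass : Set Word := prefixSet [0, 1, 0] 2 fun g n => if g = 0 then 3 ≤ n else n = 1

theorem occ_eq_zero_of_square_mem_muClass {a b w : Word} (h : a * w ^ 2 * b ∈ muClass)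
    (ha : occ 2 a = 0) (hw : occ 2 w = 0) (hw' : occ 1 w = 0) : occ 0 w = 0 := by
  have hprefix := prefixSet.filter_prefix h (by simp [occ_mul, occ_pow, ha, hw])
  have hw₁ : 1 ∉ (toList w).filter (· ∈ [2, 0, 1, 0]) := by
    rw [← List.count_eq_zero, prefixSet.count_filter (by decide), hw']
  rw [← prefixSet.count_filter (k := 2) (L := [0, 1, 0]) (by decide)]
  simp only [pow_two, FreeMonoid.toList_mul, List.filter_append] at hprefix
  generalize (toList w).filter (· ∈ [2, 0, 1, 0]) = l at hprefix hw₁ ⊢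
  generalize (toList a).filter (· ∈ [2, 0, 1, 0]) = m at hprefix
  have hlength := hprefix.length_le
  simp only [List.length_append, List.length_cons, List.length_nil] at hlength
  rcases l with _ | ⟨c, _ | ⟨d, l⟩⟩
  · rfl
  · rcases m with _ | ⟨e, _ | ⟨f, m⟩⟩
    · obtain ⟨rfl, h⟩ : c = 0 ∧ c = 1 := by simpa using hprefix
      cases h
    · obtain ⟨-, rfl, h⟩ : e = 0 ∧ c = 1 ∧ c = 0 := by simpa using hprefix
      cases h
    · simp at hlength
  · simp only [List.length_cons] at hlength
    omega

theorem mem_muClass_of_replace {c u v : Word} (d : Word) {φ : ℕ → Word} {a b : Word}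
    (hp : a * lift φ u * b ∈ muClass) (hcu : c ∣ u) (hcv : c ∣ v) (hdu : d ∣ u)
    (hE : lift (erase [0]) u = lift (erase [0]) v)
    (h : occ 2 (a * lift φ u * b) = 1 → 3 ≤ occ 0 (a * lift φ u * b) →
      occ 1 (a * lift φ u * b) = 1 → (occ 2 (a * lift φ d) = 0 → occ 0 (a * lift φ d) ≤ 2) →
      (1 ≤ occ 2 (a * lift φ c) → 2 ≤ occ 0 (a * lift φ c)) →
      (1 ≤ occ 2 (a * lift φ c) → 1 ≤ occ 1 (a * lift φ c)) →
      (1 ≤ occ 2 (a * lift φ c) → occ 2 (a * lift φ v * b) = 1 ∧ 3 ≤ occ 0 (a * lift φ v * b) ∧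
        occ 1 (a * lift φ v * b) = 1) ∧
      (occ 2 (a * lift φ c) = 0 → occ 0 (φ 0) = 0 ∧ occ 1 (φ 0) = 0 ∧ occ 2 (φ 0) = 0)) :
    a * lift φ v * b ∈ muClass := by
  have hk : 2 ∉ [0, 1, 0] := by decide
  obtain ⟨h₁, h₂⟩ := h hp.1 (hp.2.2 0 (by decide)) (hp.2.2 1 (by decide))
    (occ_bounds hk (by decide) hdu hp).1 (occ_bounds (g := 0) hk (by decide) hcu hp).2
    (occ_bounds (g := 1) hk (by decide) hcu hp).2
  refine replace_mem hk hcu hcv hE hp (fun hc => ⟨(h₁ hc).1, ?_⟩) fun hc => ?_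
  · simpa using ⟨(h₁ hc).2.1, (h₁ hc).2.2, (h₁ hc).2.1⟩
  · simpa using ⟨(h₂ hc).2.2, (h₂ hc).1, (h₂ hc).2.1, (h₂ hc).1⟩

theorem mem_mu : MonCat.of (syntacticCon muClass).Quotient ∈
    (var {(x ^ 2, x ^ 3), (x * y * x * z * x, x * y * x * z * x ^ 2)}).carrier := by
  refine mem_var_of_syntacticCon ?_
  simp only [Set.forall_mem_insert, Set.mem_singleton_iff, forall_eq]
  refine ⟨fun φ a b => ⟨fun hp => ?_,
      fun hp => mem_muClass_of_replace (c := 1) (x ^ 3) hp ?_ ?_ ?_ rfl ?_⟩,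
    fun φ a b => ⟨
      fun hp => mem_muClass_of_replace (c := x * y * x * z) (x * y * x * z * x) hp ?_ ?_ ?_ rfl ?_,
      fun hp => mem_muClass_of_replace (c := x * y * x * z) (x * y * x * z * x) hp ?_ ?_ ?_ rfl ?_⟩⟩
  · have hsq := occ_eq_zero_of_square_mem_muClass (w := φ 0) (by simpa [x] using hp)
    refine mem_muClass_of_replace (c := 1) 1 hp (by decide) (by decide) (by decide) rfl ?_
    simp only [x, map_pow, map_one, FreeMonoid.lift_eval_of, occ_mul, occ_pow, occ_one]
    omega
  all_goals first
    | decide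
    | simp only [x, y, z, map_mul, map_pow, map_one, FreeMonoid.lift_eval_of, occ_mul, occ_pow,
        occ_one]
      omega

theorem mem_muClass {p : Word} (h : mu (x * y * x * z * x) p) : p ∈ muClass :=
  (mem_iff_of_FIC mem_mu h).1 ⟨by decide, by decide, by decide⟩

/-- The words in which the letter `1` occurs, and occurs before the letter `0` does. -/
def firstOne : Set Word := {p | ((toList p).filter (· ∈ [0, 1])).head? = some 1}

theorem mem_firstOne :
    MonCat.of (syntacticCon firstOne).Quotient ∈ (var {(x * y, x * y * x)}).carrier := by
  refine mem_var_singleton.2 (satisfies_syntacticCon.2 fun φ a b => ?_)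
  simp only [firstOne, Set.mem_ofPred_eq, x, y, map_mul, FreeMonoid.lift_eval_of,
    FreeMonoid.toList_mul, List.filter_append, List.head?_append]
  generalize (toList (φ 0)).filter (· ∈ [0, 1]) = l
  cases l <;> simp

instance decidableMemPrefixSet {L : List ℕ} {k : ℕ} {C : ℕ → ℕ → Prop} [∀ g n, Decidable (C g n)]
    (p : Word) : Decidable (p ∈ prefixSet L k C) :=
  inferInstanceAs (Decidable (_ ∧ _ ∧ _))

instance decidableMemFirstOne (p : Word) : Decidable (p ∈ firstOne) :=
  inferInstanceAs (Decidable (_ = _))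

/-! ### Joins with `𝐇` and with `𝐌_ν([yx²ty]^ν)` and `𝐌_η([xyzx²ty]^η)` -/

theorem FIC_H_sq : FIC H (x * y * x) (x * y * x ^ 2) :=
  FIC_mono inf_le_left (FIC_var (by simp))

theorem FIC_H_append : FIC H (x * y * x * z) (x * y * x * z * x) := by
  have hsq : FIC H (x ^ 2 * y) (x ^ 2 * y * x) := FIC_mono inf_le_left (FIC_var (by simp))
  have h₁ : FIC H (x * y * x * z) (x * y * x ^ 2 * z) := FIC_context FIC_H_sq of 1 z rfl rfl
  have h₂ : FIC H (x * y * x ^ 2 * z) (x * y * x ^ 2 * z * x) :=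
    FIC_context hsq (fun | 0 => x | _ => z) (x * y) 1 rfl rfl
  have h₃ : FIC H (x * y * x * z * x) (x * y * x ^ 2 * z * x) :=
    FIC_context FIC_H_sq of 1 (z * x) rfl rfl
  exact (FIC H).trans ((FIC H).trans h₁ h₂) ((FIC H).symm h₃)

theorem FIC_var_nu_erase (a b : Word) :
    FIC (var {(x * y, x * y * x)}) (a * x * b) (a * x * lift (erase [0]) b) := by
  have hinsert (a c b : Word) : FIC (var {(x * y, x * y * x)}) (a * x * c * b)
      (a * x * c * x * b) :=
    FIC_context (FIC_var rfl) (fun | 0 => x | _ => c) a b (by simp [x, y, mul_assoc])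
      (by simp [x, y, mul_assoc])
  induction b using FreeMonoid.inductionOn' generalizing a with
  | one => exact (FIC _).refl _
  | of_mul c b ih =>
    rw [map_mul (lift (erase [0])), FreeMonoid.lift_eval_of, erase, ← mul_assoc, ← mul_assoc]
    split_ifs with hc
    · rw [List.mem_singleton.1 hc]
      have hsq := hinsert a 1 b
      rw [mul_one] at hsq ⊢
      exact (FIC _).trans ((FIC _).symm hsq) (ih a)
    · exact (FIC _).trans (hinsert a (of c) b)
        ((FIC _).trans (ih (a * x * of c)) ((FIC _).symm (hinsert a (of c) _)))

theorem FIC_var_nu {u v : Word} (a b c : Word) (hu : u = a * x * b) (hv : v = a * x * c)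
    (hbc : lift (erase [0]) b = lift (erase [0]) c) : FIC (var {(x * y, x * y * x)}) u v := by
  have hc := (FIC _).symm (FIC_var_nu_erase a c)
  rw [← hbc] at hc
  rw [hu, hv]
  exact (FIC _).trans (FIC_var_nu_erase a b) hc

theorem FIC_var_eta :
    FIC (var {(x * y * x * z, x * y * x * z * x), (y * t * x ^ 2 * y, y * t * y * x ^ 2)})
      (x * y * x * z) (x * y * x * z * x) := FIC_var (Or.inl rfl)

theorem nu_iff {u v : Word} :
    nu u v ↔ FIC (var {(x * y, x * y * x)}) u v ∧ FIC (varM (x * y * x)) u v := FIC_sup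

theorem eta_iff {u v : Word} :
    eta u v ↔
      FIC (var {(x * y * x * z, x * y * x * z * x), (y * t * x ^ 2 * y, y * t * y * x ^ 2)}) u v ∧
        FIC (varM (x * y * x)) u v := FIC_sup

theorem nu_le_FIC_xyx : nu ≤ FIC (varM (x * y * x)) := fun _ _ h => (nu_iff.1 h).2

theorem eta_le_FIC_xyx : eta ≤ FIC (varM (x * y * x)) := fun _ _ h => (eta_iff.1 h).2

theorem FIC_varMα_nu {w u v : Word} (a b c : Word) (hu : u = a * x * b) (hv : v = a * x * c)
    (hbc : lift (erase [0]) b = lift (erase [0]) c) (hu' : 3 ≤ occ 0 u) (hv' : 3 ≤ occ 0 v) :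
    FIC (varMα nu w) u v := by
  refine FIC_varMα_FIC (FIC_sup.2 ⟨FIC_var_nu a b c hu hv hbc, FIC_xyx_of_erase hu' hv' ?_⟩)
  rw [hu, hv, map_mul (lift (erase [0])) (a * x), map_mul (lift (erase [0])) (a * x), hbc]

theorem FIC_varMα_eta {w u v : Word}
    (h : FIC (var {(x * y * x * z, x * y * x * z * x), (y * t * x ^ 2 * y, y * t * y * x ^ 2)}) u v)
    (hu : 3 ≤ occ 0 u) (hv : 3 ≤ occ 0 v) (he : lift (erase [0]) u = lift (erase [0]) v) :
    FIC (varMα eta w) u v :=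
  FIC_varMα_FIC (FIC_sup.2 ⟨h, FIC_xyx_of_erase hu hv he⟩)

theorem not_FIC_varMα_nu {w u v : Word} (φ : ℕ → Word) (hw : w ∈ firstOne)
    (hu : nu w (lift φ u)) (hv : lift φ v ∉ firstOne) : ¬ FIC (varMα nu w) u v :=
  not_FIC_varMα φ hu fun h => hv ((mem_iff_of_FIC mem_firstOne (nu_iff.1 h).1).1 hw)

theorem not_FIC_varMα_eta {w u v : Word} (φ : ℕ → Word)
    (hw : w ∈ prefixSet [0, 1] 2 fun _ n => 2 ≤ n) (hu : eta w (lift φ u))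
    (hv : lift φ v ∉ prefixSet [0, 1] 2 fun _ n => 2 ≤ n) : ¬ FIC (varMα eta w) u v :=
  not_FIC_varMα φ hu fun h => hv ((mem_iff_of_FIC
    (mem_var_eta (by decide) (by decide) (by decide)) (eta_iff.1 h).1).1 hw)

theorem not_FIC_H {u v : Word} (hu : u ∈ prefixSet [0, 1] 2 fun _ n => 2 ≤ n)
    (hv : v ∉ prefixSet [0, 1] 2 fun _ n => 2 ≤ n) : ¬ FIC H u v := fun h =>
  hv ((mem_iff_of_FIC (mem_H (by decide) (by decide) (by decide)) h).1 hu)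

theorem not_isSubword_of_FIC_H {u p : Word} {g k : ℕ} (h : FIC H u p) (hk : k ≠ g)
    (hu : u ∈ prefixSet [g] k fun _ n => 2 ≤ n) : ¬ IsSubword (of g * of g * of k) p := fun hs => by
  have hp := (mem_iff_of_FIC (mem_H (by simpa using hk) (by simp) (by simp)) h).1 hu
  simpa using (sublist_of_isSubword hp (f := of g * of g) (by simp) hs).length_le

theorem nu_cube : nu (y * x ^ 2 * t * y) (y * x ^ 3 * t * y) :=
  nu_iff.2 ⟨FIC_var_nu y (x * t * y) (x ^ 2 * t * y) rfl rfl rfl, FIC_xyx_cube y (t * y)⟩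

theorem nonmodular_gam_H : HasNonmodularSubvarietyLattice (varMα gam (x ^ 2 * y) ⊔ H) := by
  refine nonmodular_of_swap (u := x * y * z * x * t * y) (v := y * x * z * x * t * y)
    (e₁ := x * y * z * x * t * y * x) (e₂ := y * x * z * x * t * y * x) 3 [t * x, y * y * t]
    preservesSimple_gam (m := 1) (by decide) (by decide) (by decide) (by decide)
    (FIC_context FIC_H_append (fun | 0 => x | 1 => y * z | _ => t * y) 1 1 rfl rfl)
    (FIC_context FIC_H_append (fun | 0 => x | 1 => z | _ => t * y) y 1 rfl rfl)
    (not_FIC_H (by decide) (by decide)) (fun p hpA hpB => ?_)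
    (by decide) (by decide) (by decide) (by decide)
  simp only [List.forall_mem_cons, List.not_mem_nil, false_imp_iff, implies_true, and_true]
  exact ⟨not_isSubword_of_varMα_gam 3 (by decide) hpA (by decide),
    not_isSubword_of_FIC_H hpB (by decide) (by decide)⟩

theorem nonmodular_xyx_H : HasNonmodularSubvarietyLattice (varM (x * y * x) ⊔ H) :=
  nonmodular_xyx (u := x * y * z * x * t * y) (v := y * x * z * x * t * y)
    (e₁ := x * y * z * x ^ 2 * t * y) (e₂ := y * x * z * x ^ 2 * t * y) 2 3 rfl rfl
    (by decide) (by decide) (by decide) (by decide)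
    (FIC_context FIC_H_sq (fun | 0 => x | _ => y * z) 1 (t * y) rfl rfl)
    (FIC_context FIC_H_sq (fun | 0 => x | _ => z) y (t * y) rfl rfl)
    (not_FIC_H (by decide) (by decide)) (by decide) (by decide) (by decide) (by decide)

theorem nonmodular_gam_nu : HasNonmodularSubvarietyLattice
    (varMα gam (x ^ 2 * y) ⊔ varMα nu (y * x ^ 2 * t * y)) := by
  refine nonmodular_of_swap (u := y * x ^ 3 * t * y) (v := x * y * x ^ 2 * t * y)
    (e₁ := y * x ^ 3 * t * y * x) (e₂ := x * y * x ^ 2 * t * y * x) 3 [t * x, y * y * t, y * y * y]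
    preservesSimple_gam (m := 1) (by decide) (by decide) (by decide) (by decide)
    (FIC_varMα_nu y (x ^ 2 * t * y) (x ^ 2 * t * y * x) rfl rfl rfl (by decide) (by decide))
    (FIC_varMα_nu 1 (y * x ^ 2 * t * y) (y * x ^ 2 * t * y * x) rfl rfl rfl (by decide)
      (by decide))
    (not_FIC_varMα_nu (erase []) (by decide) nu_cube (by decide))
    (fun p hpA hpB => ?_) (by decide) (by decide) (by decide) (by decide)
  simp only [List.forall_mem_cons, List.not_mem_nil, false_imp_iff, implies_true, and_true]
  refine ⟨not_isSubword_of_varMα_gam 3 (by decide) hpA (by decide), ?_, ?_⟩ <;>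
  exact not_isSubword_of_varMα nu_le_FIC_xyx hpB (erase []) nu_cube [1, 3] rfl (by decide)

theorem nonmodular_gam_eta : HasNonmodularSubvarietyLattice
    (varMα gam (x ^ 2 * y) ⊔ varMα eta (x * y * z * x ^ 2 * t * y)) := by
  refine nonmodular_of_swap (u := x * y * z * x ^ 2 * t * y) (v := y * x * z * x ^ 2 * t * y)
    (e₁ := x * y * z * x ^ 2 * t * y * x) (e₂ := y * x * z * x ^ 2 * t * y * x) 3
    [t * x, y * y * t, y * y * y] preservesSimple_gam (m := 1) (by decide) (by decide)
    (by decide) (by decide)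
    (FIC_varMα_eta (FIC_context FIC_var_eta
      (fun | 0 => x | 1 => y * z | _ => x * t * y) 1 1 rfl rfl) (by decide) (by decide) rfl)
    (FIC_varMα_eta (FIC_context FIC_var_eta
      (fun | 0 => x | 1 => z | _ => x * t * y) y 1 rfl rfl) (by decide) (by decide) rfl)
    (not_FIC_varMα_eta (erase []) (by decide) (by exact eta.refl _) (by decide))
    (fun p hpA hpB => ?_) (by decide) (by decide) (by decide) (by decide)
  simp only [List.forall_mem_cons, List.not_mem_nil, false_imp_iff, implies_true, and_true]
  refine ⟨not_isSubword_of_varMα_gam 3 (by decide) hpA (by decide), ?_, ?_⟩ <;>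
  exact not_isSubword_of_varMα eta_le_FIC_xyx hpB (erase []) (by exact eta.refl _) [1, 3] rfl
    (by decide)

theorem nonmodular_lam_nu : HasNonmodularSubvarietyLattice
    (varMα lam (x * y * x) ⊔ varMα nu (y * x ^ 2 * t * y)) := by
  have hclass : nu (y * x ^ 2 * t * y) (y * x * t * y * x ^ 2) :=
    nu.trans nu_cube (nu_iff.2 ⟨FIC_var_nu y (x ^ 2 * t * y) (t * y * x ^ 2) rfl rfl rfl,
      FIC_xyx_of_erase (by decide) (by decide) rfl⟩)
  refine nonmodular_of_swap (u := y * x * t * y * x ^ 2) (v := x * y * t * y * x ^ 2)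
    (e₁ := y * x ^ 2 * t * y * x) (e₂ := x ^ 2 * y * t * y * x) 3 [x * x * t, t * y * y, y * y * y]
    preservesSimple_lam (m := 1) (by decide) (by decide) (by decide) (by decide)
    (FIC_varMα_nu y (t * y * x ^ 2) (x * t * y * x) rfl rfl rfl (by decide) (by decide))
    (FIC_varMα_nu 1 (y * t * y * x ^ 2) (x * y * t * y * x) rfl rfl rfl (by decide) (by decide))
    (not_FIC_varMα_nu (erase []) (by decide) hclass (by decide))
    (fun p hpA hpB => ?_) (by decide) (by decide) (by decide) (by decide)
  simp only [List.forall_mem_cons, List.not_mem_nil, false_imp_iff, implies_true, and_true]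
  refine ⟨not_isSubword_of_varMα_lam 3 (by decide) hpA (by decide), ?_, ?_⟩ <;>
  exact not_isSubword_of_varMα nu_le_FIC_xyx hpB (erase []) hclass [1, 3] rfl (by decide)

theorem nonmodular_xyxzx_nu : HasNonmodularSubvarietyLattice
    (varM (x * y * x * z * x) ⊔ varMα nu (y * x ^ 2 * t * y)) := by
  have hclass : nu (y * x ^ 2 * t * y) (y * x * x * t * x * y) :=
    nu.trans nu_cube (nu_iff.2 ⟨FIC_var_nu y (x ^ 2 * t * y) (x * t * x * y) rfl rfl rfl,
      FIC_xyx_of_erase (by decide) (by decide) rfl⟩)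
  exact nonmodular_xyxzx (u := y * x * z * x * t * x * y) (v := x * y * z * x * t * x * y)
    (e₁ := y * x * z * x * t * x ^ 2 * y) (e₂ := x * y * z * x * t * x ^ 2 * y) 2 3 2 rfl rfl
    (by decide) (by decide) (by decide) (by decide)
    (FIC_varMα_nu y (z * x * t * x * y) (z * x * t * x ^ 2 * y) rfl rfl rfl (by decide) (by decide))
    (FIC_varMα_nu 1 (y * z * x * t * x * y) (y * z * x * t * x ^ 2 * y) rfl rfl rfl (by decide)
      (by decide))
    (not_FIC_varMα_nu (erase [2]) (by decide) hclass (by decide)) (by decide) (by decide)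
    (by decide) (by decide)

/-! ### Joins with `𝐌_μ(xyxzx⁺)` -/

theorem le_occ_iff_isSubword {g n : ℕ} {p : Word} : n ≤ occ g p ↔ IsSubword (of g ^ n) p := by
  rw [IsSubword, toList_of_pow, List.replicate_sublist_iff]
  rfl

theorem prefixSet.isSubword {L : List ℕ} {k : ℕ} {C : ℕ → ℕ → Prop} {p : Word}
    (h : p ∈ prefixSet L k C) : IsSubword (FreeMonoid.ofList (L ++ [k])) p :=
  h.2.1.sublist.trans List.filter_sublist

theorem not_isSubword_of_mem_muClass {p : Word} (h : p ∈ muClass) :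
    ¬ IsSubword (x * x * x * z) p := fun hs =>
  absurd (prefixSet.sublist_of_isSubword (f := x * x * x) h (by decide) hs) (by decide)

theorem occ_lift_restrict {l : List ℕ} {i : ℕ} (hi : i < l.length) (hl : l.Nodup) (p : Word) :
    occ i (lift (restrict l) p) = occ l[i] p := by
  induction p using FreeMonoid.inductionOn' with
  | one => rfl
  | of_mul b p ih =>
    rw [map_mul, FreeMonoid.lift_eval_of, occ_mul, occ_mul, ih, restrict]
    congr 1
    split_ifs with hb
    · have hidx : l.idxOf b = i ↔ b = l[i] :=
        ⟨fun h => by simp [← h], fun h => by rw [h, hl.idxOf_getElem]⟩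
      simp only [occ_of, hidx]
    · rw [occ_one, occ_of, if_neg]
      rintro rfl
      exact hb (List.getElem_mem hi)

theorem nonmodular_mu {B : Variety}
    (hu : FIC B (x * y * z * x * t * y * s * x) (x * y * z * x ^ 2 * t * y * s * x))
    (hv : FIC B (y * x * z * x * t * y * s * x) (y * x * z * x ^ 2 * t * y * s * x))
    (hV : ¬ FIC B (x * y * z * x * t * y * s * x) (y * x * z * x * t * y * s * x)) :
    HasNonmodularSubvarietyLattice (varMα mu (x * y * x * z * x) ⊔ B) := by
  refine nonmodular_of_swap 4 [x * x * x * s, s * y, y * y * y] preservesSimple_mu (m := 1)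
    (by decide) (by decide) (by decide) (by decide) hu hv hV (fun p hpA _ => ?_) (by decide)
    (by decide) (by decide) (by decide)
  have hclass (l : List ℕ) (a b : Word)
      (h : x * y * x * z * x = a * lift (restrict l) (x * y * z * x * t * y * s * x) * b) :
      a * lift (restrict l) p * b ∈ muClass :=
    mem_muClass (class_of_FIC_varMα hpA _ a b (by rw [← h]; exact mu.refl _))
  have hyyy : ¬ IsSubword (y * y * y) p := fun hs =>
    not_isSubword_of_mem_muClass (hclass [1, 2] 1 (z * x) rfl)
      (IsSubword.trans (by decide) ((hs.lift (restrict [1, 2])).mul (.refl (z * x))))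
  have hxxxs : ¬ IsSubword (x * x * x * s) p := fun hs =>
    not_isSubword_of_mem_muClass (hclass [0, 2, 4] 1 1 rfl)
      ((hs.lift (restrict [0, 2, 4])).context 1 1)
  have hsy : ¬ IsSubword (s * y) p := fun hs => by
    have hq : lift (restrict [1, 2, 4]) p * x ∈ muClass := hclass [1, 2, 4] 1 x rfl
    have hs' : IsSubword (z * (x * x)) (lift (restrict [1, 2, 4]) p * x) :=
      (hs.lift (restrict [1, 2, 4])).mul (.refl x)
    have hocc : 4 ≤ occ 0 (lift (restrict [1, 2, 4]) p * x) :=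
      (IsSubword.glue (f := x * y * x) hq.1 (prefixSet.isSubword hq) hs').occ_le 0
    rw [occ_mul, occ_lift_restrict (by decide) (by decide)] at hocc
    have hy : 3 ≤ occ 1 p := Nat.le_of_add_le_add_right (b := 1) hocc
    exact hyyy (le_occ_iff_isSubword.1 hy)
  simp only [List.forall_mem_cons, List.not_mem_nil, false_imp_iff, implies_true, and_true]
  exact ⟨hxxxs, hsy, hyyy⟩

theorem nonmodular_mu_lam' : HasNonmodularSubvarietyLattice
    (varMα mu (x * y * x * z * x) ⊔ varMα lam' (x * y * z * x * t * y * s * x)) :=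
  nonmodular_mu
    (FIC_varMα_lam' (c := x * y * z) (d := t * y * s * x) 2 rfl (by decide) (by decide) (by decide))
    (FIC_varMα_lam' (c := y * x * z) (d := t * y * s * x) 2 rfl (by decide) (by decide) (by decide))
    (not_FIC_varMα (erase []) (by exact lam'.refl _) fun h => absurd h.1.1.2 (by decide))

theorem nonmodular_mu_eta : HasNonmodularSubvarietyLattice
    (varMα mu (x * y * x * z * x) ⊔ varMα eta (x * y * z * x ^ 2 * t * y)) := by
  have hmove : FIC (var {(x * y * x * z, x * y * x * z * x),
      (y * t * x ^ 2 * y, y * t * y * x ^ 2)}) (x * y * z * x ^ 2 * t * y)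
      (x * y * z * x * t * y * x) :=
    (FIC _).trans ((FIC _).symm
      (FIC_context FIC_var_eta (fun | 0 => x | 1 => y * z | _ => 1) 1 (t * y) rfl rfl))
      (FIC_context FIC_var_eta (fun | 0 => x | 1 => y * z | _ => t * y) 1 1 rfl rfl)
  have hclass : eta (x * y * z * x ^ 2 * t * y) (x * y * z * x * t * y * x) :=
    eta_iff.2 ⟨hmove, FIC_xyx_of_erase (by decide) (by decide) rfl⟩
  exact nonmodular_mu
    (FIC_varMα_eta (FIC_context FIC_var_eta
      (fun | 0 => x | 1 => y * z | _ => 1) 1 (t * y * s * x) rfl rfl) (by decide) (by decide) rfl)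
    (FIC_varMα_eta (FIC_context FIC_var_eta
      (fun | 0 => x | 1 => z | _ => 1) y (t * y * s * x) rfl rfl) (by decide) (by decide) rfl)
    (not_FIC_varMα_eta (erase [4]) (by decide) hclass (by decide))

/-! ### Joins with `𝐍` -/

theorem commute_of_adjacent {w a b X Y Z : Word} (h : w = a * (X * Y * Z) * b)
    (hw : ∀ g ∈ toList w, occ g w ≤ 2)
    (hadj : ∀ c d l, c ≠ d → c :: d :: l <:+ toList w → c ∈ l → d ∉ l)
    (hX : ∀ g, occ g X ≤ occ g Z) (hY : ∀ g, occ g Y ≤ occ g Z) : X * Y = Y * X := by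
  have hsimple (g : ℕ) : occ g X + occ g Y ≤ 1 := by
    by_contra! hg
    have hX := hX g
    have hY := hY g
    have hocc : occ g w = occ g a + (occ g X + occ g Y + occ g Z) + occ g b := by
      rw [h, occ_mul, occ_mul, occ_mul, occ_mul]
    have := hw g (mem_iff_occ.2 (by omega))
    omega
  rcases List.eq_nil_or_concat (toList X) with hX1 | ⟨X', c, hXc⟩
  · rw [toList.injective (a₂ := 1) hX1, one_mul, mul_one]
  rcases hYd : toList Y with _ | ⟨d, Y'⟩
  · rw [toList.injective (a₂ := 1) hYd, one_mul, mul_one]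
  have hcX : 1 ≤ occ c X := mem_iff_occ.1 (by simp [hXc])
  have hdY : 1 ≤ occ d Y := mem_iff_occ.1 (by simp [hYd])
  have hcd : c ≠ d := by
    rintro rfl
    have := hsimple c
    omega
  refine absurd ?_ (hadj c d (Y' ++ toList Z ++ toList b) hcd ⟨toList a ++ X', ?_⟩ ?_)
  · exact List.mem_append_left _ (List.mem_append_right _ (mem_iff_occ.2 (hdY.trans (hY d))))
  · rw [h]
    simp [hXc, hYd]
  · exact List.mem_append_left _ (List.mem_append_right _ (mem_iff_occ.2 (hcX.trans (hX c))))

theorem FIC_varM_swap_prefix {w q : Word} (hw : ∀ g ∈ toList w, occ g w ≤ 2)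
    (hadj : ∀ c d l, c ≠ d → c :: d :: l <:+ toList w → c ∈ l → d ∉ l) (h0 : 1 ≤ occ 0 q)
    (h1 : 1 ≤ occ 1 q) : FIC (varM w) (x * y * q) (y * x * q) := by
  rw [varM_eq_varMα_bot]
  refine FIC_varMα_of_divides fun φ hd => ?_
  have hocc {c : ℕ} (hc : 1 ≤ occ c q) (g : ℕ) :
      occ g (lift φ (of c)) ≤ occ g (lift φ q) :=
    (Nat.le_mul_of_pos_left _ hc).trans (mul_occ_le_occ_lift φ g c q)
  have hcomm : lift φ x * lift φ y = lift φ y * lift φ x := by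
    rcases hd with ⟨a, b, h⟩ | ⟨a, b, h⟩
    · exact commute_of_adjacent (by rw [← map_mul, ← map_mul]; exact h) hw hadj (hocc h0) (hocc h1)
    · exact (commute_of_adjacent (by rw [← map_mul, ← map_mul]; exact h) hw hadj
        (hocc h1) (hocc h0)).symm
  rw [map_mul (lift φ), map_mul (lift φ), map_mul (lift φ), map_mul (lift φ), hcomm]
  exact (⊥ : Con Word).refl _

theorem length_lift_restrict {l : List ℕ} (hl : l.Nodup) (p : Word) :
    (toList (lift (restrict l) p)).length = (l.map (occ · p)).sum := by
  induction p using FreeMonoid.inductionOn' with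
  | one => simp [occ_one]
  | of_mul b p ih =>
    rw [map_mul, FreeMonoid.lift_eval_of, FreeMonoid.toList_mul, List.length_append, ih]
    simp only [occ_mul, List.sum_map_add, occ_of, restrict]
    congr 1
    have hcount (l : List ℕ) : (l.map fun i => if b = i then 1 else 0).sum = l.count b := by
      induction l with
      | nil => rfl
      | cons c l ih =>
        rw [List.map_cons, List.sum_cons, ih, List.count_cons]
        grind
    rw [hcount, hl.count]
    split_ifs <;> rfl

/-- If `f` were a subword of `p`, then `p` would coincide with `f` on the letters of `l`, but the
identities of `𝐌(w)` determine whether this is so. -/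
theorem not_isSubword_of_occ_le {w u p f : Word} {l : List ℕ} (h : FIC (varM w) u p)
    (hl : l.Nodup) (hf : lift (restrict l) f = w) (hu : toList (lift (restrict l) u) ≠ toList w)
    (hp : ∀ i ∈ l, ¬ IsSubword (of i ^ (occ i f + 1)) p) : ¬ IsSubword f p := fun hs => by
  have hocc (i : ℕ) (hi : i ∈ l) : occ i p ≤ occ i f := by
    have := hp i hi
    rwa [← le_occ_iff_isSubword, not_le, Nat.lt_succ_iff] at this
  have hlength : (toList (lift (restrict l) p)).length ≤ (toList w).length := by
    rw [← hf, length_lift_restrict hl, length_lift_restrict hl]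
    exact List.sum_le_sum hocc
  have hw : w = lift (restrict l) p :=
    toList.injective (List.Sublist.eq_of_length_le (hf ▸ hs.lift (restrict l)) hlength)
  exact hu (congrArg toList (FIC_varM_restrict ((FIC _).symm h) l hw.symm))

theorem isSubword_of_lift_restrict {l : List ℕ} {p q : Word} (h : lift (restrict l) p = q) :
    IsSubword (lift (fun i => of (l.getD i 0)) q) p := by
  subst h
  rw [FreeMonoid.hom_map_lift]
  refine (IsSubword.lift_mono (ψ := of) (fun i => ?_) p).trans ?_
  · rw [Function.comp_apply, restrict]
    split_ifs with hi
    · rw [FreeMonoid.lift_eval_of, List.getD_eq_getElem _ _ (List.idxOf_lt_length_iff.2 hi),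
        List.getElem_idxOf]
      exact .refl _
    · exact .one _
  · rw [lift_of]
    exact .refl _

/-- The position of the images of `xyzxy` or `yxzxy` in a word with the multiple letters `x`, `y`,
`s` and the simple letter `z`: the factor `H Z K`, where `H` and `K` are made of the same
letters, which include `x` and `y` but not `s`, and `Z` contains `z`. -/
structure IsSplitting (H Z K : Word) : Prop where
  occ_eq (g : ℕ) : occ g H = occ g K
  mem_x : 1 ≤ occ 0 K
  mem_y : 1 ≤ occ 1 K
  notMem_s : occ 4 K = 0
  mem_z : 1 ≤ occ 2 Z

theorem occ_middle_of_not_isSubword {a b H Z K : Word} {k g : ℕ}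
    (hHK : ∀ g, occ g H = occ g K) (hg : 1 ≤ occ g K) (hk : occ k (a * H * Z * K * b) = 1)
    (h₁ : ¬ IsSubword (of k * of g * of g) (a * H * Z * K * b))
    (h₂ : ¬ IsSubword (of g * of g * of k) (a * H * Z * K * b)) : 1 ≤ occ k Z := by
  have hgH := of_isSubword_iff.2 (hg.trans_eq (hHK g).symm)
  have hgK := of_isSubword_iff.2 hg
  by_contra hZ
  have hH := hHK k
  simp only [occ_mul] at hk
  rcases (by omega : 1 ≤ occ k a ∨ 1 ≤ occ k b) with ha | hb
  · exact h₁ (((((of_isSubword_iff.2 ha).mul hgH).mul_right Z).mul hgK).mul_right b)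
  · exact h₂ ((((hgH.mul_left a).mul_right Z).mul hgK).mul (of_isSubword_iff.2 hb))

theorem isSplitting_of_not_isSubword {a b H Z K : Word} {i j : ℕ}
    (hHK : ∀ g, occ g H = occ g K) (hi : 1 ≤ occ i K) (hj : 1 ≤ occ j K) (hij : i ≠ j)
    (hz : occ 2 (a * H * Z * K * b) = 1)
    (hmul : ∀ g, 2 ≤ occ g (a * H * Z * K * b) → g = 0 ∨ g = 1 ∨ g = 4)
    (hF : ∀ f ∈ [z * x * x, x * x * z, z * y * y, y * y * z, s * z],
      ¬ IsSubword f (a * H * Z * K * b)) : IsSplitting H Z K := by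
  simp only [List.forall_mem_cons, List.not_mem_nil, false_imp_iff, implies_true, and_true] at hF
  obtain ⟨hzxx, hxxz, hzyy, hyyz, hsz⟩ := hF
  have hletters (g : ℕ) (hg : 1 ≤ occ g K) : g = 0 ∨ g = 1 ∨ g = 4 := by
    refine hmul g ?_
    have := hHK g
    simp only [occ_mul]
    omega
  have hletters_i := hletters i hi
  have hletters_j := hletters j hj
  have hxy : 1 ≤ occ 0 K ∨ 1 ≤ occ 1 K := by
    rcases hletters_i with rfl | rfl | rfl <;> rcases hletters_j with rfl | rfl | rfl <;> omega
  have hZ : 1 ≤ occ 2 Z := by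
    rcases hxy with hx | hy
    · exact occ_middle_of_not_isSubword hHK hx hz hzxx hxxz
    · exact occ_middle_of_not_isSubword hHK hy hz hzyy hyyz
  have hs : occ 4 K = 0 := by
    by_contra hs
    have hsH := of_isSubword_iff.2 ((Nat.one_le_iff_ne_zero.2 hs).trans_eq (hHK 4).symm)
    exact hsz ((((hsH.mul_left a).mul (of_isSubword_iff.2 hZ)).mul_right K).mul_right b)
  refine ⟨hHK, ?_, ?_, hs, hZ⟩ <;>
    rcases hletters_i with rfl | rfl | rfl <;> rcases hletters_j with rfl | rfl | rfl <;> omega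

theorem nonmodular_N {w m q r : Word} {k : ℕ} (hk : occ k w = 1)
    (hw : ∀ g ∈ toList w, occ g w ≤ 2)
    (hadj : ∀ c d l, c ≠ d → c :: d :: l <:+ toList w → c ∈ l → d ∉ l)
    (hu : FIC N (x * y * q) (x * y * (m * x * y * r)))
    (hv : FIC N (y * x * q) (y * x * (m * x * y * r)))
    (h0 : 1 ≤ occ 0 q) (h1 : 1 ≤ occ 1 q) (hV : ¬ FIC N (x * y * q) (y * x * q))
    (hz : occ 2 (x * y * q) = 1)
    (hmul : ∀ g ∈ toList (x * y * q), 2 ≤ occ g (x * y * q) → g = 0 ∨ g = 1 ∨ g = 4)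
    (hF : ∀ p, FIC (varM w) (x * y * q) p →
      ∀ f ∈ [z * x * x, x * x * z, z * y * y, y * y * z, s * z], ¬ IsSubword f p)
    (hsplit : ∀ a b H Z K, IsSplitting H Z K → ¬ FIC (varM w) (x * y * q) (a * H * Z * K * b)) :
    HasNonmodularSubvarietyLattice (varM w ⊔ N) := by
  refine nonmodular_of_trivial_instances
    (FIC_varM_swap_prefix hw hadj
      (of_isSubword_iff.1 ((((IsSubword.refl x).mul_left m).mul_right y).mul_right r))
      (of_isSubword_iff.1 (((IsSubword.refl y).mul_left (m * x)).mul_right r)))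
    (FIC_varM_swap_prefix hw hadj h0 h1) (inf_var_le_var hu hv) (fun h => hV (FIC_sup.1 h).2)
    fun φ a b h => ?_
  have hcomm {H : Word} (hH : ∀ g, occ g H = occ g (φ 0 * φ 1))
      (hp : FIC (varM w) (x * y * q) (a * H * lift φ m * (φ 0 * φ 1) * (lift φ r * b))) :
      φ 0 * φ 1 = φ 1 * φ 0 := by
    have hp' := hp
    rw [varM_eq_varMα_bot] at hp'
    have hocc := preservesSimple_bot.FIC_varMα hk _ _ hp'
    refine commute_of_forall_mem_eq fun i hi j hj => ?_
    by_contra hij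
    rw [mem_iff_occ] at hi hj
    refine hsplit _ _ _ _ _ (isSplitting_of_not_isSubword hH (i := i) (j := j) ?_ ?_ hij ?_ ?_
      (hF _ hp)) hp
    · rw [occ_mul]; omega
    · rw [occ_mul]; omega
    · have := hocc 2; omega
    · intro g hg
      have := hocc g
      exact hmul g (mem_iff_occ.2 (by omega)) (by omega)
  have hφ : φ 0 * φ 1 = φ 1 * φ 0 := by
    rcases h with h | h
    · refine hcomm (H := φ 0 * φ 1) (fun _ => rfl) ?_
      simpa [x, y, mul_assoc] using (FIC_sup.1 h).1
    · refine hcomm (H := φ 1 * φ 0) (fun g => by rw [occ_mul, occ_mul, add_comm]) ?_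
      simpa [x, y, mul_assoc] using (FIC_sup.1 h).1
  simp [x, y, ← mul_assoc, hφ]

theorem not_FIC_N {u v : Word} (hu : u ∈ prefixSet [0, 1] 2 fun _ n => n = 2)
    (hv : v ∉ prefixSet [0, 1] 2 fun _ n => n = 2) : ¬ FIC N u v := fun h =>
  hv ((mem_iff_of_FIC (mem_N (by decide) (by decide) (by decide)) h).1 hu)

theorem not_FIC_xzxyty_of_isSplitting {a b H Z K : Word} (h : IsSplitting H Z K) :
    ¬ FIC (varM (x * z * x * y * t * y)) (x * y * (z * x * s * y * t * s))
      (a * H * Z * K * b) := fun hp => by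
  have havoid {f : Word} := not_isSubword_of_FIC_restrict (f := f) hp [0, 4, 2, 3] rfl
  have hyyy : ¬ IsSubword (y * y * y) (a * H * Z * K * b) :=
    not_isSubword_of_FIC_varM (φ := restrict [1, 7, 2]) (a := 1) (b := y * t * y) hp rfl (by decide)
  have hyzysts : ¬ IsSubword (y * z * y * (s * t * s)) (a * H * Z * K * b) :=
    not_isSubword_of_occ_le (l := [1, 4, 2, 3]) hp (by decide) rfl (by decide) (by
      simp only [List.forall_mem_cons, List.not_mem_nil, false_imp_iff, implies_true, and_true]
      exact ⟨hyyy, havoid (by decide), havoid (by decide), havoid (by decide)⟩)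
  have hs : occ 4 (a * H * Z) = 0 := by
    by_contra hs
    have hsx := (of_isSubword_iff.2 (Nat.one_le_iff_ne_zero.2 hs)).mul (of_isSubword_iff.2 h.mem_x)
    exact havoid (f := s * x) (by decide) (hsx.mul_right b)
  have hs' : 4 ∉ toList (a * H * Z * K) := by
    rw [mem_iff_occ, occ_mul, hs, h.notMem_s]
    decide
  have hpin : IsSubword (x * z * x * s * t * s) (a * H * Z * K * b) :=
    isSubword_of_lift_restrict (FIC_varM_restrict hp [0, 4, 2, 3] rfl)
  have hsts : IsSubword (s * t * s) b :=
    sublist_of_cons_sublist_append (g := [3, 4]) hs'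
      ((by decide : IsSubword (s * t * s) (x * z * x * s * t * s)).trans hpin)
  have hyH := of_isSubword_iff.2 (h.mem_y.trans_eq (h.occ_eq 1).symm)
  exact hyzysts ((((hyH.mul_left a).mul (of_isSubword_iff.2 h.mem_z)).mul
    (of_isSubword_iff.2 h.mem_y)).mul hsts)

theorem nonmodular_xzxyty_N :
    HasNonmodularSubvarietyLattice (varM (x * z * x * y * t * y) ⊔ N) := by
  have hN : FIC N (x * z * x * y * t * y) (x * z * y * x * t * y) := FIC_var (by simp)
  refine nonmodular_N (q := z * x * s * y * t * s) (m := z) (r := s * t * s) (k := 2) rfl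
    (by decide) ?_
    ((FIC _).symm
      (FIC_context hN (fun | 0 => y | 1 => s | 2 => z * x | _ => t) x 1 rfl rfl))
    ((FIC _).symm
      (FIC_context hN (fun | 0 => y | 1 => s | 2 => x * z * x | _ => t) 1 1 rfl rfl))
    (by decide) (by decide)
    (not_FIC_N (by decide) (by decide)) rfl (by decide) ?_ ?_
  · have htoList : toList (x * z * x * y * t * y) = [0, 2, 0, 1, 3, 1] := rfl
    simp only [htoList, List.suffix_cons_iff, List.suffix_nil]
    rintro c d l hcd h
    grind
  · intro p hp
    have havoid {f : Word} := not_isSubword_of_FIC_restrict (f := f) hp [0, 4, 2, 3] rfl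
    have havoid_y {f : Word} := not_isSubword_of_FIC_varM (f := f) (φ := restrict [1, 7, 2])
      (a := 1) (b := y * t * y) hp rfl
    simp only [List.forall_mem_cons, List.not_mem_nil, false_imp_iff, implies_true, and_true]
    exact ⟨havoid (by decide), havoid (by decide), havoid_y (by decide), havoid_y (by decide),
      havoid (by decide)⟩
  · exact fun _ _ _ _ _ h => not_FIC_xzxyty_of_isSplitting h

theorem not_FIC_xzytxy_of_isSplitting {a b H Z K : Word} (h : IsSplitting H Z K) :
    ¬ FIC (varM (x * z * y * t * x * y)) (x * y * (z * s * t * x * s * y))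
      (a * H * Z * K * b) := fun hp => by
  have havoid {f : Word} := not_isSubword_of_FIC_restrict (f := f) hp [0, 4, 2, 3] rfl
  have hyyy : ¬ IsSubword (y * y * y) (a * H * Z * K * b) :=
    not_isSubword_of_FIC_varM (φ := fun | 1 => x | 2 => z * y * t | _ => 1) (a := 1) (b := y) hp
      rfl (by decide)
  have hyzstys : ¬ IsSubword (y * z * s * t * y * s) (a * H * Z * K * b) :=
    not_isSubword_of_occ_le (l := [1, 4, 2, 3]) hp (by decide) rfl (by decide) (by
      simp only [List.forall_mem_cons, List.not_mem_nil, false_imp_iff, implies_true, and_true]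
      exact ⟨hyyy, havoid (by decide), havoid (by decide), havoid (by decide)⟩)
  have hpin := FIC_varM_restrict hp [0, 4, 2, 3] rfl
  have hocc (i : ℕ) (hi : i < 4) :=
    occ_lift_restrict (l := [0, 4, 2, 3]) hi (by decide) (a * H * Z * K * b)
  rw [hpin] at hocc
  have hocc_s : occ 4 (a * H * Z * K * b) = 2 := (hocc 1 (by decide)).symm
  have hocc_z : occ 2 (a * H * Z * K * b) = 1 := (hocc 2 (by decide)).symm
  have hocc_t : occ 3 (a * H * Z * K * b) = 1 := (hocc 3 (by decide)).symm
  have htZ : 1 ≤ occ 3 Z :=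
    occ_middle_of_not_isSubword h.occ_eq h.mem_x hocc_t (havoid (by decide)) (havoid (by decide))
  have hsb : 1 ≤ occ 4 b := by
    have hsK := h.notMem_s
    have hsH := h.occ_eq 4
    have hs : ¬ 2 ≤ occ 4 (a * H * Z) := fun hs =>
      havoid (f := of 4 ^ 2 * x) (by decide)
        (((le_occ_iff_isSubword.1 hs).mul (of_isSubword_iff.2 h.mem_x)).mul_right b)
    simp only [occ_mul] at hocc_s hs
    omega
  have hyH := of_isSubword_iff.2 (h.mem_y.trans_eq (h.occ_eq 1).symm)
  have hyz : IsSubword (y * z) (a * H * Z * K * b) :=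
    (((hyH.mul_left a).mul (of_isSubword_iff.2 h.mem_z)).mul_right K).mul_right b
  have htys : IsSubword (t * (y * s)) (a * H * Z * K * b) :=
    (((of_isSubword_iff.2 htZ).mul_left (a * H)).mul (of_isSubword_iff.2 h.mem_y)).mul
      (of_isSubword_iff.2 hsb)
  have hzst : IsSubword (z * (s * t)) (a * H * Z * K * b) :=
    (by decide : IsSubword (z * (s * t)) (x * z * s * t * x * s)).trans
      (isSubword_of_lift_restrict hpin)
  have hyzst : IsSubword (y * z * s * t) (a * H * Z * K * b) :=
    IsSubword.glue (f := y) (k := 2) (g := s * t) hocc_z hyz hzst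
  exact hyzstys (IsSubword.glue (f := y * z * s) (k := 3) (g := y * s) hocc_t hyzst htys)

theorem nonmodular_xzytxy_N :
    HasNonmodularSubvarietyLattice (varM (x * z * y * t * x * y) ⊔ N) := by
  have hN : FIC N (x * z * y * t * x * y) (x * z * y * t * y * x) := FIC_var (by simp)
  refine nonmodular_N (q := z * s * t * x * s * y) (m := z * s * t) (r := s) (k := 2) rfl
    (by decide) ?_
    ((FIC _).symm (FIC_context hN (fun | 0 => y | 1 => s | 2 => z | _ => t * x) x 1 rfl rfl))
    ((FIC _).symm (FIC_context hN (fun | 0 => y | 1 => s | 2 => x * z | _ => t * x) 1 1 rfl rfl))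
    (by decide) (by decide) (not_FIC_N (by decide) (by decide)) rfl (by decide) ?_ ?_
  · have htoList : toList (x * z * y * t * x * y) = [0, 2, 1, 3, 0, 1] := rfl
    simp only [htoList, List.suffix_cons_iff, List.suffix_nil]
    rintro c d l hcd h
    grind
  · intro p hp
    have havoid {f : Word} := not_isSubword_of_FIC_restrict (f := f) hp [0, 4, 2, 3] rfl
    have havoid_y {f : Word} := not_isSubword_of_FIC_varM (f := f)
      (φ := fun | 1 => x | 2 => z * y * t | _ => 1) (a := 1) (b := y) hp rfl
    simp only [List.forall_mem_cons, List.not_mem_nil, false_imp_iff, implies_true, and_true]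
    exact ⟨havoid (by decide), havoid (by decide), havoid_y (by decide), havoid_y (by decide),
      havoid (by decide)⟩
  · exact fun _ _ _ _ _ h => not_FIC_xzytxy_of_isSplitting h

end MonVar

/-- A class written by a regular expression, such as `xx⁺y` for `γ`, is given here by a word in it,
such as `x²y`; `varMα α w` is the variety `𝐌_α([w]^α)`. -/
theorem proposition4p1 :
    -- (i) `𝐌_γ(xx⁺y) ∨ 𝐇`
    HasNonmodularSubvarietyLattice (varMα gam (x ^ 2 * y) ⊔ H) ∧
    -- (ii) `𝐌_γ(xx⁺y) ∨ 𝐌_ν([yx²ty]^ν)`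
    HasNonmodularSubvarietyLattice (varMα gam (x ^ 2 * y) ⊔ varMα nu (y * x ^ 2 * t * y)) ∧
    -- (iii) `𝐌_γ(xx⁺y) ∨ 𝐌_η([xyzx²ty]^η)`
    HasNonmodularSubvarietyLattice
      (varMα gam (x ^ 2 * y) ⊔ varMα eta (x * y * z * x ^ 2 * t * y)) ∧
    -- (iv) `𝐌_λ(xyx⁺) ∨ 𝐌_λ̄(x⁺yx)`
    HasNonmodularSubvarietyLattice (varMα lam (x * y * x) ⊔ varMα (dualCon lam) (x * y * x)) ∧
    -- (v) `𝐌_λ(xyx⁺) ∨ 𝐌_ν([yx²ty]^ν)`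
    HasNonmodularSubvarietyLattice (varMα lam (x * y * x) ⊔ varMα nu (y * x ^ 2 * t * y)) ∧
    -- (vi) `𝐌_λ(xyx⁺) ∨ 𝐌_γ'(yxx⁺ty)`
    HasNonmodularSubvarietyLattice (varMα lam (x * y * x) ⊔ varMα gam' (y * x ^ 2 * t * y)) ∧
    -- (vii) `𝐌_λ(xyx⁺) ∨ 𝐌_γ'(ytyxx⁺)`
    HasNonmodularSubvarietyLattice (varMα lam (x * y * x) ⊔ varMα gam' (y * t * y * x ^ 2)) ∧
    -- (viii) `𝐌_λ(xyx⁺) ∨ 𝐌_γ'([x²yzytx²]^γ')`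
    HasNonmodularSubvarietyLattice
      (varMα lam (x * y * x) ⊔ varMα gam' (x ^ 2 * y * z * y * t * x ^ 2)) ∧
    -- (ix) `𝐌_λ(xyx⁺) ∨ 𝐌_γ'([x²yzx²ty]^γ')`
    HasNonmodularSubvarietyLattice
      (varMα lam (x * y * x) ⊔ varMα gam' (x ^ 2 * y * z * x ^ 2 * t * y)) ∧
    -- (x) `𝐌_λ(xyx⁺) ∨ 𝐌_γ'([yzx²ytx²]^γ')`
    HasNonmodularSubvarietyLattice
      (varMα lam (x * y * x) ⊔ varMα gam' (y * z * x ^ 2 * y * t * x ^ 2)) ∧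
    -- (xi) `𝐌_λ(xyx⁺) ∨ 𝐌_γ'([x²zytx²y]^γ')`
    HasNonmodularSubvarietyLattice
      (varMα lam (x * y * x) ⊔ varMα gam' (x ^ 2 * z * y * t * x ^ 2 * y)) ∧
    -- (xii) `𝐌(xyx) ∨ 𝐇`
    HasNonmodularSubvarietyLattice (varM (x * y * x) ⊔ H) ∧
    -- (xiii) `𝐌(xyx) ∨ 𝐌_λ(xyzx⁺ty⁺)`
    HasNonmodularSubvarietyLattice (varM (x * y * x) ⊔ varMα lam (x * y * z * x * t * y)) ∧
    -- (xiv) `𝐌(xyx) ∨ 𝐌_λ(xx⁺yty⁺)`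
    HasNonmodularSubvarietyLattice (varM (x * y * x) ⊔ varMα lam (x ^ 2 * y * t * y)) ∧
    -- (xv) `𝐌(xyxzx) ∨ 𝐌_ν([yx²ty]^ν)`
    HasNonmodularSubvarietyLattice
      (varM (x * y * x * z * x) ⊔ varMα nu (y * x ^ 2 * t * y)) ∧
    -- (xvi) `𝐌(xyxzx) ∨ 𝐌_γ'(yxx⁺ty)`
    HasNonmodularSubvarietyLattice
      (varM (x * y * x * z * x) ⊔ varMα gam' (y * x ^ 2 * t * y)) ∧
    -- (xvii) `𝐌(xyxzx) ∨ 𝐌_γ'(xx⁺yty)`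
    HasNonmodularSubvarietyLattice
      (varM (x * y * x * z * x) ⊔ varMα gam' (x ^ 2 * y * t * y)) ∧
    -- (xviii) `𝐌(xyxzx) ∨ 𝐌_λ'(xyzxx⁺ty)`
    HasNonmodularSubvarietyLattice
      (varM (x * y * x * z * x) ⊔ varMα lam' (x * y * z * x ^ 2 * t * y)) ∧
    -- (xix) `𝐌(xyxzx) ∨ 𝐌_λ'(xyzytxx⁺)`
    HasNonmodularSubvarietyLattice
      (varM (x * y * x * z * x) ⊔ varMα lam' (x * y * z * y * t * x ^ 2)) ∧
    -- (xx) `𝐌(xyxzx) ∨ 𝐌_λ'(yzyxtxx⁺)`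
    HasNonmodularSubvarietyLattice
      (varM (x * y * x * z * x) ⊔ varMα lam' (y * z * y * x * t * x ^ 2)) ∧
    -- (xxi) `𝐌_μ(xyxzx⁺) ∨ 𝐌_λ'(xyzx⁺tysx⁺)`
    HasNonmodularSubvarietyLattice
      (varMα mu (x * y * x * z * x) ⊔ varMα lam' (x * y * z * x * t * y * s * x)) ∧
    -- (xxii) `𝐌_μ(xyxzx⁺) ∨ 𝐌_η([xyzx²ty]^η)`
    HasNonmodularSubvarietyLattice
      (varMα mu (x * y * x * z * x) ⊔ varMα eta (x * y * z * x ^ 2 * t * y)) ∧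
    -- (xxiii) `𝐌(xzxyty) ∨ 𝐍`
    HasNonmodularSubvarietyLattice (varM (x * z * x * y * t * y) ⊔ N) ∧
    -- (xxiv) `𝐌(xzytxy) ∨ 𝐍`
    HasNonmodularSubvarietyLattice (varM (x * z * y * t * x * y) ⊔ N) :=
  ⟨nonmodular_gam_H, nonmodular_gam_nu, nonmodular_gam_eta, nonmodular_lam_dual, nonmodular_lam_nu,
    nonmodular_lam_gam'_yx2ty, nonmodular_lam_gam'_ytyx2, nonmodular_lam_gam'_x2yzytx2,
    nonmodular_lam_gam'_x2yzx2ty, nonmodular_lam_gam'_yzx2ytx2, nonmodular_lam_gam'_x2zytx2y,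
    nonmodular_xyx_H, nonmodular_xyx_lam_xyzxty, nonmodular_xyx_lam_x2yty, nonmodular_xyxzx_nu,
    nonmodular_xyxzx_gam'_yx2ty, nonmodular_xyxzx_gam'_x2yty, nonmodular_xyxzx_lam'_xyzx2ty,
    nonmodular_xyxzx_lam'_xyzytx2, nonmodular_xyxzx_lam'_yzyxtx2, nonmodular_mu_lam',
    nonmodular_mu_eta, nonmodular_xzxyty_N, nonmodular_xzytxy_N⟩
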